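/- Let $a,b,d$ be nonzero real constants and $h=h(x)$ a smooth function on $\mathbb{R}$, and let $$\begin{aligned}F={}&-u_1-\tfrac32 a\,u_0u_1-\tfrac16 b\,u_3+\tfrac38a^2u_0^2u_1-\tfrac{23}{24}ab\,u_1u_2-\tfrac5{12}ab\,u_0u_3\\&+\tfrac d2(h'u_0+hu_1)+\tfrac14bd(-h'''u_0-h''u_1+h'u_2+hu_3)-\tfrac{19}{360}b^2u_5\end{aligned}$$ be the right-hand side of the Karczewska–Rozmej–Rutkowski–Infeld (KRRI) equation $u_t=F$, where $u_j$ denotes the $j$th $x$-derivative of $u$ (so $u_0=u$). Let $\mathcal A$ be the algebra of smooth real functions of $t,x$ and finitely many of $u_0,u_1,u_2,\dots$, with the total derivatives $D_x=\partial_x+\sum_{j\ge0}u_{j+1}\partial_{u_j}$ and $D_t=\partial_t+\sum_{j\ge0}D_x^j(F)\,\partial_{u_j}$. Let $\mathcal B$ be the algebra of formal series $L=\sum_{i=-\infty}^{p}a_iD^i$ with $p\in\mathbb Z$ and $a_i\in\mathcal A$, multiplied by the generalized Leibniz rule $aD^i\circ bD^j=\sum_{k\ge0}\binom ik\,a\,D_x^k(b)\,D^{i+j-k}$;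 put $D_t(L)=\sum_i D_t(a_i)D^i$ and $L^\dagger=\sum_i(-D)^i\circ a_i$, and let $\deg L$ be the greatest $i$ with $a_i\ne0$ (with $\deg 0=-\infty$). For $f\in\mathcal A$ let $f_*=\sum_{i\ge0}\frac{\partial f}{\partial u_i}D^i$. A formal symplectic operator (formal conservation law) of rank $k\in\mathbb Z$ for the KRRI equation is a nonzero $L\in\mathcal B$ such that $$\deg\bigl(D_t(L)+F_*^\dagger\circ L+L\circ F_*\bigr)\le\deg L+\deg F_*-k .$$ Then the KRRI equation has no formal symplectic operator of rank $k$ for any $k\ge10$ (in particular, none of rank greater than $10$). Moreover, if $h$ is not constant, then it has no formal symplectic operator of rank $k$ for any $k\ge6$. -/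

import Mathlib

open scoped ContDiff

noncomputable section

namespace KRRI

/-- Real-valued functions `f t x u` of `t`, `x` and the jet coordinates `u 0, u 1, u 2, …`
(`u j` stands for the `j`-th `x`-derivative of the dependent variable). -/
abbrev JetFun : Type := ℝ → ℝ → (ℕ → ℝ) → ℝ

/-- The algebra of local functions: `f` is a smooth function of `t`, `x` and of finitely many
of the `u j`. -/
def IsLocal (f : JetFun) : Prop :=
  ∃ (n : ℕ) (g : ℝ × ℝ × (Fin n → ℝ) → ℝ), ContDiff ℝ ∞ g ∧
    ∀ (t x : ℝ) (u : ℕ → ℝ), f t x u = g (t, x, fun i => u i)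

/-- `∂f/∂t`. -/
def partialT (f : JetFun) : JetFun := fun t x u => deriv (fun s => f s x u) t

/-- `∂f/∂x` (the jet coordinates being kept fixed). -/
def partialX (f : JetFun) : JetFun := fun t x u => deriv (fun s => f t s u) x

/-- `∂f/∂u_j`. -/
def partialU (j : ℕ) (f : JetFun) : JetFun :=
  fun t x u => deriv (fun s => f t x (Function.update u j s)) (u j)

/-- The total `x`-derivative `D_x = ∂/∂x + ∑_j u_{j+1} ∂/∂u_j`; on a local function
only finitely many terms of the sum are nonzero. -/
def Dx (f : JetFun) : JetFun := fun t x u =>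
  partialX f t x u + ∑ᶠ j : ℕ, u (j + 1) * partialU j f t x u

/-- The total `t`-derivative `D_t = ∂/∂t + ∑_j D_x^j(F) ∂/∂u_j` restricted to the evolution
equation `u_t = F`. -/
def Dt (F f : JetFun) : JetFun := fun t x u =>
  partialT f t x u + ∑ᶠ j : ℕ, (Dx^[j] F) t x u * partialU j f t x u

/-- A two-sided sequence of coefficients; `L i` is the coefficient at `D ^ i`. -/
abbrev Series : Type := ℤ → JetFun

/-- Membership in the algebra of formal series `∑_{i ≤ p} a_i D^i` with local coefficients. -/
def IsFormalSeries (L : Series) : Prop :=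
  (∀ i, IsLocal (L i)) ∧ ∃ p : ℤ, ∀ i, p < i → L i = 0

open Classical in
/-- The degree of a formal series: the greatest `i` with nonzero coefficient at `D ^ i`,
and `⊥` (that is, `-∞`) for the zero series. -/
def deg (L : Series) : WithBot ℤ :=
  if L = 0 then ⊥ else ((sSup {i : ℤ | L i ≠ 0} : ℤ) : WithBot ℤ)

/-- The product of formal series, determined by the generalized Leibniz rule
`a D^i ∘ b D^j = ∑_k (i choose k) a D_x^k(b) D^(i+j-k)`: the coefficient at `D ^ m` is the sum
over all `i` and `k`, with `j = m - i + k`. For series bounded from above only finitely many terms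
are nonzero. `Ring.choose i k` is `i (i-1) ⋯ (i-k+1) / k!` for every integer `i`. -/
def comp (A B : Series) : Series := fun m t x u =>
  ∑ᶠ p : ℤ × ℕ, A p.1 t x u * ((Ring.choose p.1 p.2 : ℤ) : ℝ) *
    (Dx^[p.2] (B (m - p.1 + p.2))) t x u

/-- The formal adjoint `Q† = ∑_j (-D)^j ∘ b_j` of `Q = ∑_j b_j D^j`: since
`D^j ∘ b = ∑_k (j choose k) D_x^k(b) D^(j-k)`, the coefficient at `D ^ m` is the
sum over `k` with `j = m + k`. -/
def adjoint (Q : Series) : Series := fun m t x u =>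
  ∑ᶠ k : ℕ, (-1 : ℝ) ^ (m + (k : ℤ)) * ((Ring.choose (m + (k : ℤ)) k : ℤ) : ℝ) *
    (Dx^[k] (Q (m + k))) t x u

/-- The linearization `f_* = ∑_{i ≥ 0} ∂f/∂u_i D^i`. -/
def linearization (f : JetFun) : Series := fun i =>
  if 0 ≤ i then partialU i.toNat f else 0

/-- The coefficientwise action of `D_t` on series. -/
def DtSeries (F : JetFun) (L : Series) : Series := fun i => Dt F (L i)

/-- `L` is a formal symplectic operator (formal conservation law) of rank `k` for the evolution
equation `u_t = F`: a nonzero formal series with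
`deg (D_t(L) + F_*† ∘ L + L ∘ F_*) ≤ deg L + deg F_* - k`. The term `k` is moved to the left, as
degrees may be `-∞`. -/
def IsFormalSymplecticOperator (F : JetFun) (L : Series) (k : ℤ) : Prop :=
  IsFormalSeries L ∧ L ≠ 0 ∧
    deg (DtSeries F L + comp (adjoint (linearization F)) L + comp L (linearization F)) +
        ((k : ℤ) : WithBot ℤ) ≤
      deg L + deg (linearization F)

/-- The right-hand side of the Karczewska–Rozmej–Rutkowski–Infeld equation. -/
def rhs (a b d : ℝ) (h : ℝ → ℝ) : JetFun := fun _ x u =>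
  -u 1 - 3 / 2 * a * u 0 * u 1 - 1 / 6 * b * u 3
    + 3 / 8 * a ^ 2 * u 0 ^ 2 * u 1 - 23 / 24 * a * b * u 1 * u 2
    - 5 / 12 * a * b * u 0 * u 3
    + d / 2 * (iteratedDeriv 1 h x * u 0 + h x * u 1)
    + 1 / 4 * b * d * (-(iteratedDeriv 3 h x) * u 0 - iteratedDeriv 2 h x * u 1
        + iteratedDeriv 1 h x * u 2 + h x * u 3)
    - 19 / 360 * b ^ 2 * u 5

end KRRI

end

/-! Write `L = Σ l_q D^(n-q)` with `l_0 ≠ 0`. Since `F_* = c D^5 +` (order at most 3) with `c`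
constant, the coefficient at `D^(n+5-s)` of the symplectic condition is free of `l_s` and contains
`l_(s-1)` only as `D_x l_(s-1)`. Rank `r` thus amounts to a chain of equations, `s < r`, that
prescribe `D_x l_(s-1)` in terms of `l_q` with `q ≤ s - 2` (`residual_eq`). Each asks that some
expression be a total derivative. The one with `s = 1` makes `l_0` a function of `t` alone.

Rank ten: give `u_j` weight `j + 2` and functions of `t, x` weight zero. Then `D_x` raises weight by
one, and the part of `F` of top weight seven does not involve `h`. With `a = k b` and `v = k u` this
part is a fixed equation up to the factor `b^2`, so the top-weight part of `l_q` for `q ≤ 7` must be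
`l_0` times a universal polynomial in `v_j` and `n` (`leadingTerm_coeff`). At `s = 9` what is left
over is `l_0 (12717 n + 67797) v_1^3`, up to a nonzero constant and total derivatives. The factor
vanishes for no integer `n`, and a cube of `u_1` is not a total derivative even modulo lower weight
(`eq_zero_of_totalX_eq_cube`); hence `l_0 = 0`.

Rank six: write the coefficients at `D^3` and `D^2` of `F_*` as `p` and `D_x q`. The equations up to
`s = 5` force `D_t l_0` plus a nonzero constant times `l_0 p D_x q` to be a total derivative
(`exists_potential`). Both `p` and `q` are affine in `h` and `u`, with equal coefficients at `h` and
different ones at `u`. So `p D_x q` equals a nonzero multiple of `h' u` modulo total derivatives,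
and `l_0 h' = 0` follows (`leading_mul_deriv_eq_zero`). For constant `h` this obstruction
disappears. -/

noncomputable section

namespace KRRI

/-! ### Local functions as a commutative algebra, with commuting partial derivations. -/

/-- The independent variables and the jet coordinates. -/
inductive JetVar : Type
  | t : JetVar
  | x : JetVar
  | u : ℕ → JetVar

/-- The coordinate vector of a jet variable in the space of `t`, `x` and the first `n` jet
coordinates; it is zero for `u j` with `n ≤ j`. -/
def JetVar.vec (n : ℕ) : JetVar → ℝ × ℝ × (Fin n → ℝ)
  | .t => (1, 0, 0)
  | .x => (0, 1, 0)
  | .u j => (0, 0, fun i => if (i : ℕ) = j then 1 else 0)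

/-- The partial derivative with respect to a jet variable. -/
def pd : JetVar → JetFun → JetFun
  | .t => partialT
  | .x => partialX
  | .u j => partialU j

/-- `g` is a smooth function of `t`, `x` and the first `n` jet coordinates that induces `f`. -/
def Represents (n : ℕ) (g : ℝ × ℝ × (Fin n → ℝ) → ℝ) (f : JetFun) : Prop :=
  ContDiff ℝ ∞ g ∧ ∀ (t x : ℝ) (u : ℕ → ℝ), f t x u = g (t, x, fun i => u i)

theorem IsLocal.exists_represents_of_le {f : JetFun} (hf : IsLocal f) :
    ∃ n, ∀ m, n ≤ m → ∃ g, Represents m g f := by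
  obtain ⟨n, g, hg, h⟩ := hf
  refine ⟨n, fun m hm => ⟨fun p => g (p.1, p.2.1, fun i => p.2.2 (Fin.castLE hm i)), ?_, ?_⟩⟩
  · exact hg.comp (by fun_prop)
  · intro t x u
    rw [h]
    rfl

theorem Represents.isLocal {n : ℕ} {g : ℝ × ℝ × (Fin n → ℝ) → ℝ} {f : JetFun}
    (h : Represents n g f) : IsLocal f := ⟨n, g, h.1, h.2⟩

theorem exists_common_represents {f₁ f₂ : JetFun} (h₁ : IsLocal f₁) (h₂ : IsLocal f₂) :
    ∃ n g₁ g₂, Represents n g₁ f₁ ∧ Represents n g₂ f₂ := by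
  obtain ⟨n₁, h₁⟩ := h₁.exists_represents_of_le
  obtain ⟨n₂, h₂⟩ := h₂.exists_represents_of_le
  obtain ⟨g₁, hg₁⟩ := h₁ (max n₁ n₂) (le_max_left _ _)
  obtain ⟨g₂, hg₂⟩ := h₂ (max n₁ n₂) (le_max_right _ _)
  exact ⟨_, g₁, g₂, hg₁, hg₂⟩

theorem Represents.pd {n : ℕ} {g : ℝ × ℝ × (Fin n → ℝ) → ℝ} {f : JetFun}
    (h : Represents n g f) (c : JetVar) :
    Represents n (fun p => fderiv ℝ g p (c.vec n)) (pd c f) := by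
  refine ⟨(h.1.fderiv_right (m := ∞) (by simp)).clm_apply contDiff_const, fun t x u => ?_⟩
  have hd : ∀ p, HasFDerivAt g (fderiv ℝ g p) p := fun p =>
    ((h.1.differentiable (by simp)) p).hasFDerivAt
  cases c with
  | t =>
    simp only [KRRI.pd, partialT, h.2]
    exact ((hd _).comp_hasDerivAt t
      ((hasDerivAt_id t).prodMk ((hasDerivAt_const t x).prodMk (hasDerivAt_const t _)))).deriv
  | x =>
    simp only [KRRI.pd, partialX, h.2]
    exact ((hd _).comp_hasDerivAt x
      ((hasDerivAt_const x t).prodMk ((hasDerivAt_id x).prodMk (hasDerivAt_const x _)))).deriv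
  | u j =>
    simp only [KRRI.pd, partialU, h.2]
    have hc : HasDerivAt (fun s => fun i : Fin n => Function.update u j s i)
        (fun i : Fin n => if (i : ℕ) = j then 1 else 0) (u j) := by
      rw [hasDerivAt_pi]
      intro i
      by_cases hi : (i : ℕ) = j
      · simpa [hi] using hasDerivAt_id' (u j)
      · simpa [hi] using hasDerivAt_const (u j) (u i)
    have h0 : (t, x, fun i : Fin n => u i) =
        (t, x, fun i : Fin n => Function.update u j (u j) i) := by simp
    rw [h0]
    exact ((hd _).comp_hasDerivAt (u j)
      ((hasDerivAt_const (u j) t).prodMk ((hasDerivAt_const (u j) x).prodMk hc))).deriv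

theorem Represents.ext {n : ℕ} {g : ℝ × ℝ × (Fin n → ℝ) → ℝ} {f₁ f₂ : JetFun}
    (h₁ : Represents n g f₁) (h₂ : Represents n g f₂) : f₁ = f₂ := by
  funext t x u
  rw [h₁.2, h₂.2]

theorem Represents.add {n : ℕ} {g₁ g₂ : ℝ × ℝ × (Fin n → ℝ) → ℝ} {f₁ f₂ : JetFun}
    (h₁ : Represents n g₁ f₁) (h₂ : Represents n g₂ f₂) :
    Represents n (fun p => g₁ p + g₂ p) (f₁ + f₂) :=
  ⟨h₁.1.add h₂.1, fun t x u => by simp [h₁.2, h₂.2]⟩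

theorem Represents.mul {n : ℕ} {g₁ g₂ : ℝ × ℝ × (Fin n → ℝ) → ℝ} {f₁ f₂ : JetFun}
    (h₁ : Represents n g₁ f₁) (h₂ : Represents n g₂ f₂) :
    Represents n (fun p => g₁ p * g₂ p) (f₁ * f₂) :=
  ⟨h₁.1.mul h₂.1, fun t x u => by simp [h₁.2, h₂.2]⟩

theorem Represents.smul {n : ℕ} {g : ℝ × ℝ × (Fin n → ℝ) → ℝ} {f : JetFun}
    (h : Represents n g f) (r : ℝ) : Represents n (fun p => r * g p) (r • f) :=
  ⟨contDiff_const.mul h.1, fun t x u => by simp [h.2]⟩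

/-- The algebra of local functions. -/
def localFun : Subalgebra ℝ JetFun where
  carrier := {f | IsLocal f}
  mul_mem' h₁ h₂ := by
    obtain ⟨n, g₁, g₂, h₁, h₂⟩ := exists_common_represents h₁ h₂
    exact (h₁.mul h₂).isLocal
  add_mem' h₁ h₂ := by
    obtain ⟨n, g₁, g₂, h₁, h₂⟩ := exists_common_represents h₁ h₂
    exact (h₁.add h₂).isLocal
  algebraMap_mem' r := ⟨0, fun _ => r, contDiff_const, fun _ _ _ => rfl⟩

instance : CommRing localFun := localFun.toCommRing

instance : CommSemiring localFun := CommRing.toCommSemiring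

instance : Semiring localFun := CommSemiring.toSemiring

instance : Algebra ℝ localFun := localFun.algebra

instance : Module ℝ localFun := Algebra.toModule

/-- Partial differentiation as a derivation of the algebra of local functions. -/
def pder (c : JetVar) : Derivation ℝ localFun localFun :=
  Derivation.mk'
    { toFun := fun f => ⟨pd c f.1, by
        obtain ⟨n, g, h⟩ := f.2
        exact (Represents.pd h c).isLocal⟩
      map_add' := fun f₁ f₂ => by
        obtain ⟨n, g₁, g₂, h₁, h₂⟩ := exists_common_represents f₁.2 f₂.2
        refine Subtype.ext (((h₁.add h₂).pd c).ext ?_)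
        convert (h₁.pd c).add (h₂.pd c) using 2 with p
        · rw [fderiv_fun_add (h₁.1.differentiable (by simp) p) (h₂.1.differentiable (by simp) p)]
          rfl
        · rfl
      map_smul' := fun r f => by
        obtain ⟨n, g, h⟩ := f.2
        replace h : Represents n g f.1 := h
        refine Subtype.ext (((h.smul r).pd c).ext ?_)
        convert (h.pd c).smul r using 2 with p
        · rw [fderiv_const_mul (h.1.differentiable (by simp) p)]
          rfl
        · rfl }
    (fun f₁ f₂ => by
      obtain ⟨n, g₁, g₂, h₁, h₂⟩ := exists_common_represents f₁.2 f₂.2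
      refine Subtype.ext (((h₁.mul h₂).pd c).ext ?_)
      convert (h₁.mul (h₂.pd c)).add (h₂.mul (h₁.pd c)) using 2 with p
      · rw [fderiv_fun_mul (h₁.1.differentiable (by simp) p) (h₂.1.differentiable (by simp) p)]
        rfl
      · rfl)

theorem coe_pder (c : JetVar) (f : localFun) : (pder c f : JetFun) = pd c f := rfl

theorem pder_comm (c c' : JetVar) (f : localFun) : pder c (pder c' f) = pder c' (pder c f) := by
  obtain ⟨n, g, h⟩ := f.2
  replace h : Represents n g f.1 := h
  refine Subtype.ext (((h.pd c').pd c).ext ?_)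
  convert (h.pd c).pd c' using 2 with p
  swap
  · rfl
  have hd : DifferentiableAt ℝ (fderiv ℝ g) p :=
    (h.1.fderiv_right (m := ∞) (by simp)).differentiable (by simp) p
  have hs : IsSymmSndFDerivAt ℝ g p :=
    h.1.contDiffAt.isSymmSndFDerivAt (by
      simpa using WithTop.coe_le_coe.mpr (le_top (a := (2 : ℕ∞))))
  rw [fderiv_clm_apply hd (by fun_prop), fderiv_clm_apply hd (by fun_prop)]
  simpa using hs.eq _ _

theorem exists_pder_u_eq_zero (f : localFun) : ∃ n, ∀ j, n ≤ j → pder (.u j) f = 0 := by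
  obtain ⟨n, g, h⟩ := f.2
  replace h : Represents n g f.1 := h
  refine ⟨n, fun j hj => Subtype.ext ?_⟩
  have h0 : JetVar.vec n (.u j) = 0 := by
    simp only [JetVar.vec, Prod.mk_eq_zero, true_and]
    funext i
    have := i.2
    simp only [Pi.zero_apply, ite_eq_right_iff, one_ne_zero, imp_false]
    omega
  funext t x u
  rw [coe_pder, (h.pd _).2, h0]
  simp

/-- The jet coordinate `u j` as a local function. -/
def jet (j : ℕ) : localFun :=
  ⟨fun _ _ u => u j, j + 1, fun p => p.2.2 (Fin.last j), by fun_prop, fun _ _ _ => rfl⟩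

/-- A smooth function of `x` as a local function. -/
def ofX (h : ℝ → ℝ) (hh : ContDiff ℝ ∞ h) : localFun :=
  ⟨fun _ x _ => h x, 0, fun p => h p.2.1, hh.comp (by fun_prop), fun _ _ _ => rfl⟩

@[simp] theorem pder_x_jet (j : ℕ) : pder .x (jet j) = 0 := by
  refine Subtype.ext ?_
  funext t x u
  simp [coe_pder, pd, partialX, jet]

@[simp] theorem pder_u_jet (i j : ℕ) : pder (.u i) (jet j) = if i = j then 1 else 0 := by
  refine Subtype.ext ?_
  funext t x u
  by_cases hij : i = j
  · subst hij
    simp [coe_pder, pd, partialU, jet]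
  · have : j ≠ i := fun h => hij h.symm
    simp [coe_pder, pd, partialU, jet, hij, this]

@[simp] theorem pder_u_ofX (j : ℕ) (h : ℝ → ℝ) (hh : ContDiff ℝ ∞ h) :
    pder (.u j) (ofX h hh) = 0 := by
  refine Subtype.ext ?_
  funext t x u
  simp [coe_pder, pd, partialU, ofX]

/-! ### Total and evolutionary derivations. -/

/-- The derivation `∑ⱼ cⱼ ∂/∂uⱼ`. -/
def vertical (c : ℕ → localFun) : Derivation ℝ localFun localFun :=
  Derivation.mk'
    { toFun := fun f => ∑ᶠ j, c j * pder (.u j) f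
      map_add' := fun f₁ f₂ => by
        obtain ⟨n₁, h₁⟩ := exists_pder_u_eq_zero f₁
        obtain ⟨n₂, h₂⟩ := exists_pder_u_eq_zero f₂
        rw [← finsum_add_distrib]
        · simp only [map_add, mul_add]
        · refine (Set.finite_lt_nat n₁).subset fun j hj => ?_
          by_contra hlt
          exact hj (by simp [h₁ j (not_lt.mp hlt)])
        · refine (Set.finite_lt_nat n₂).subset fun j hj => ?_
          by_contra hlt
          exact hj (by simp [h₂ j (not_lt.mp hlt)])
      map_smul' := fun r f => by
        obtain ⟨n, h⟩ := exists_pder_u_eq_zero f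
        rw [RingHom.id_apply, smul_finsum' r]
        · refine finsum_congr fun j => ?_
          rw [Derivation.map_smul, mul_smul_comm]
        · refine (Set.finite_lt_nat n).subset fun j hj => ?_
          by_contra hlt
          exact hj (by simp [h j (not_lt.mp hlt)]) }
    (fun f₁ f₂ => by
        obtain ⟨n₁, h₁⟩ := exists_pder_u_eq_zero f₁
        obtain ⟨n₂, h₂⟩ := exists_pder_u_eq_zero f₂
        have e : ∀ f : localFun, (∃ n, ∀ j, n ≤ j → pder (.u j) f = 0) →
            (Function.support fun j => c j * pder (.u j) f).Finite := by
          rintro f ⟨n, h⟩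
          refine (Set.finite_lt_nat n).subset fun j hj => ?_
          by_contra hlt
          exact hj (by simp [h j (not_lt.mp hlt)])
        have e₁ := e f₁ ⟨n₁, h₁⟩
        have e₂ := e f₂ ⟨n₂, h₂⟩
        simp only [LinearMap.coe_mk, AddHom.coe_mk, smul_eq_mul]
        rw [mul_finsum' _ _ e₂, mul_finsum' _ _ e₁, ← finsum_add_distrib]
        · refine finsum_congr fun j => ?_
          rw [Derivation.leibniz]
          simp only [smul_eq_mul]
          ring
        · exact e₂.subset fun j hj h0 => hj (by simp only [h0, mul_zero])
        · exact e₁.subset fun j hj h0 => hj (by simp only [h0, mul_zero]))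

theorem vertical_apply_eq_sum (c : ℕ → localFun) (f : localFun) {n : ℕ}
    (h : ∀ j, n ≤ j → pder (.u j) f = 0) :
    vertical c f = ∑ j ∈ Finset.range n, c j * pder (.u j) f := by
  refine finsum_eq_sum_of_support_subset (fun j => c j * pder (.u j) f) fun j hj => ?_
  by_contra hlt
  simp only [Finset.coe_range, Set.mem_Iio, not_lt] at hlt
  exact hj (by simp [h j hlt])

theorem vertical_eq_zero (c : ℕ → localFun) (f : localFun) (h : ∀ j, pder (.u j) f = 0) :
    vertical c f = 0 := by
  rw [vertical_apply_eq_sum c f (n := 0) fun j _ => h j]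
  simp

@[simp] theorem vertical_jet (c : ℕ → localFun) (j : ℕ) : vertical c (jet j) = c j := by
  rw [vertical_apply_eq_sum c _ (n := j + 1)]
  · rw [Finset.sum_range_succ, Finset.sum_eq_zero]
    · simp
    · intro i hi
      have : i ≠ j := by simp at hi; omega
      simp [this]
  · intro i hi
    have : i ≠ j := by omega
    simp [this]

/-- The total `x`-derivative on local functions. -/
def totalX : Derivation ℝ localFun localFun := pder .x + vertical fun j => jet (j + 1)

/-- The evolutionary derivation `∑ⱼ Dₓʲ(G) ∂/∂uⱼ`. -/
def evolutionary (G : localFun) : Derivation ℝ localFun localFun :=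
  vertical fun j => totalX^[j] G

/-- The total `t`-derivative of the evolution equation `u_t = G`. -/
def totalT (G : localFun) : Derivation ℝ localFun localFun := pder .t + evolutionary G

theorem coe_sum_apply {ι : Type*} (s : Finset ι) (c : ι → localFun) (t x : ℝ) (u : ℕ → ℝ) :
    ((∑ j ∈ s, c j : localFun) : JetFun) t x u = ∑ j ∈ s, (c j : JetFun) t x u := by
  induction s using Finset.cons_induction with
  | empty => simp
  | cons a s ha ih =>
    rw [Finset.sum_cons, Finset.sum_cons, ← ih]
    rfl

theorem coe_vertical (c : ℕ → localFun) (f : localFun) (t x : ℝ) (u : ℕ → ℝ) :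
    (vertical c f : JetFun) t x u =
      ∑ᶠ j : ℕ, (c j : JetFun) t x u * partialU j (f : JetFun) t x u := by
  obtain ⟨n, h⟩ := exists_pder_u_eq_zero f
  rw [vertical_apply_eq_sum c f h, coe_sum_apply,
    finsum_eq_sum_of_support_subset (s := Finset.range n)]
  · rfl
  · intro j hj
    by_contra hlt
    simp only [Finset.coe_range, Set.mem_Iio, not_lt] at hlt
    apply hj
    have : partialU j (f : JetFun) = 0 := congrArg Subtype.val (h j hlt)
    simp [this]

theorem coe_totalX (f : localFun) : (totalX f : JetFun) = Dx f := by
  funext t x u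
  exact congrArg₂ (· + ·) rfl (coe_vertical _ f t x u)

theorem coe_totalX_iterate (k : ℕ) (f : localFun) :
    ((totalX^[k] f : localFun) : JetFun) = Dx^[k] f := by
  induction k with
  | zero => rfl
  | succ k ih => rw [Function.iterate_succ_apply', Function.iterate_succ_apply', coe_totalX, ih]

theorem coe_totalT (G f : localFun) : (totalT G f : JetFun) = Dt G f := by
  funext t x u
  refine (congrArg₂ (· + ·) rfl (coe_vertical _ f t x u)).trans ?_
  simp only [coe_totalX_iterate]
  rfl

@[simp] theorem totalX_jet (j : ℕ) : totalX (jet j) = jet (j + 1) := by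
  simp [totalX]

theorem totalX_ofX (h : ℝ → ℝ) (hh : ContDiff ℝ ∞ h) (hh' : ContDiff ℝ ∞ (deriv h)) :
    totalX (ofX h hh) = ofX (deriv h) hh' := by
  rw [totalX, Derivation.add_apply, vertical_eq_zero _ _ fun j => pder_u_ofX j h hh, add_zero]
  rfl

theorem pder_totalX_zero (f : localFun) :
    pder (.u 0) (totalX f) = totalX (pder (.u 0) f) := by
  obtain ⟨n, h⟩ := exists_pder_u_eq_zero f
  have h' : ∀ j, n ≤ j → pder (.u j) (pder (.u 0) f) = 0 := fun j hj => by
    rw [pder_comm, h j hj, map_zero]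
  simp only [totalX, Derivation.add_apply, map_add, vertical_apply_eq_sum _ _ h,
    vertical_apply_eq_sum _ _ h', map_sum, Derivation.leibniz, pder_u_jet, smul_eq_mul]
  rw [pder_comm]
  congr 1
  refine Finset.sum_congr rfl fun j _ => ?_
  rw [pder_comm]
  simp

/-- The commutator of `∂/∂u_(i+1)` with `D_x` is `∂/∂u_i`. This is what lets a bound on `D_x g` be
turned into bounds on the derivatives of `g`. -/
theorem pder_totalX_succ (i : ℕ) (f : localFun) :
    pder (.u (i + 1)) (totalX f) = totalX (pder (.u (i + 1)) f) + pder (.u i) f := by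
  obtain ⟨n, h⟩ := exists_pder_u_eq_zero f
  -- The cutoff also exceeds `i`, so that the summation range contains the one index where the
  -- coefficient `u_(j+1)` is differentiated to 1.
  obtain ⟨N, hN⟩ : ∃ N, N = n + i + 1 := ⟨_, rfl⟩
  have h' : ∀ j, N ≤ j → pder (.u j) (pder (.u (i + 1)) f) = 0 := fun j hj => by
    rw [pder_comm, h j (by omega), map_zero]
  have h : ∀ j, N ≤ j → pder (.u j) f = 0 := fun j hj => h j (by omega)
  simp only [totalX, Derivation.add_apply, map_add, vertical_apply_eq_sum _ _ h,
    vertical_apply_eq_sum _ _ h', map_sum, Derivation.leibniz, pder_u_jet, smul_eq_mul]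
  rw [pder_comm, add_assoc]
  congr 1
  rw [Finset.sum_add_distrib]
  congr 1
  · refine Finset.sum_congr rfl fun j _ => ?_
    rw [pder_comm]
  · rw [Finset.sum_eq_single i]
    · simp
    · intro j _ hj
      have : i ≠ j := Ne.symm hj
      simp [this]
    · intro hi
      simp at hi
      omega

/-! ### The weight filtration. -/

/-- `f` is a polynomial in the jet coordinates of weight at most `k`, where `u j` has weight
`j + 2`, with smooth functions of `t` and `x` as coefficients; only zero has negative weight. -/
inductive WeightLE : ℤ → localFun → Prop
  | zero (k : ℤ) : WeightLE k 0
  | of {k : ℤ} {f : localFun} (hk : 0 ≤ k)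
      (h : ∀ j : ℕ, WeightLE (k - 2 - j) (pder (.u j) f)) : WeightLE k f

namespace WeightLE

theorem eq_zero_of_neg {k : ℤ} {f : localFun} (h : WeightLE k f) (hk : k < 0) : f = 0 := by
  cases h with
  | zero => rfl
  | of hk' => omega

theorem pder_u {k : ℤ} {f : localFun} (h : WeightLE k f) (j : ℕ) :
    WeightLE (k - 2 - j) (pder (.u j) f) := by
  cases h with
  | zero => rw [map_zero]; exact zero _
  | of _ h => exact h j

theorem mono {k k' : ℤ} {f : localFun} (h : WeightLE k f) (hk : k ≤ k') : WeightLE k' f := by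
  induction h generalizing k' with
  | zero => exact zero _
  | of h0 _ ih => exact of (h0.trans hk) fun j => ih j (by omega)

theorem add {k : ℤ} {f g : localFun} (hf : WeightLE k f) (hg : WeightLE k g) :
    WeightLE k (f + g) := by
  induction hf generalizing g with
  | zero => rwa [zero_add]
  | of h0 _ ih =>
    refine of h0 fun j => ?_
    rw [map_add]
    exact ih j (hg.pder_u j)

theorem smul {k : ℤ} {f : localFun} (hf : WeightLE k f) (r : ℝ) : WeightLE k (r • f) := by
  induction hf with
  | zero => rw [smul_zero]; exact zero _
  | of h0 _ ih =>
    refine of h0 fun j => ?_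
    rw [Derivation.map_smul]
    exact ih j

theorem neg {k : ℤ} {f : localFun} (hf : WeightLE k f) : WeightLE k (-f) := by
  simpa using hf.smul (-1)

theorem sub {k : ℤ} {f g : localFun} (hf : WeightLE k f) (hg : WeightLE k g) :
    WeightLE k (f - g) := by
  simpa [sub_eq_add_neg] using hf.add hg.neg

theorem sum {ι : Type*} {k : ℤ} (s : Finset ι) {f : ι → localFun}
    (h : ∀ i ∈ s, WeightLE k (f i)) : WeightLE k (∑ i ∈ s, f i) :=
  Finset.sum_induction f (WeightLE k) (fun _ _ => add) (zero k) h

theorem mul {k m : ℤ} {f g : localFun} (hf : WeightLE k f) (hg : WeightLE m g) :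
    WeightLE (k + m) (f * g) := by
  induction hf generalizing m g with
  | zero => rw [zero_mul]; exact zero _
  | @of k f hk h ih =>
    have hf : WeightLE k f := of hk h
    induction hg with
    | zero => rw [mul_zero]; exact zero _
    | @of m g hm h' ih' =>
      refine of (by omega) fun j => ?_
      rw [Derivation.leibniz, smul_eq_mul, smul_eq_mul, mul_comm g]
      exact ((ih' j).mono (by omega)).add ((ih j (of hm h')).mono (by omega))

theorem of_pder_u_eq_zero {f : localFun} (h : ∀ j, pder (.u j) f = 0) : WeightLE 0 f :=
  of le_rfl fun j => by rw [h]; exact zero _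

theorem jet (j : ℕ) : WeightLE (j + 2) (jet j) := by
  refine of (by omega) fun i => ?_
  rw [pder_u_jet]
  split_ifs with h
  · exact (of_pder_u_eq_zero fun i => Derivation.map_one_eq_zero _).mono (by omega)
  · exact zero _

theorem vertical {k p : ℤ} {f : localFun} {c : ℕ → localFun} (hf : WeightLE k f)
    (hc : ∀ j : ℕ, WeightLE (j + p) (c j)) : WeightLE (k + p - 2) (vertical c f) := by
  obtain ⟨n, h⟩ := exists_pder_u_eq_zero f
  rw [vertical_apply_eq_sum c f h]
  exact sum _ fun j _ => ((hc j).mul (hf.pder_u j)).mono (by omega)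

theorem pder_of_commute {k : ℤ} {f : localFun} (hf : WeightLE k f) (c : JetVar) :
    WeightLE k (pder c f) := by
  induction hf with
  | zero => rw [map_zero]; exact zero _
  | of h0 _ ih =>
    refine of h0 fun j => ?_
    rw [pder_comm]
    exact ih j

theorem totalX {k : ℤ} {f : localFun} (hf : WeightLE k f) : WeightLE (k + 1) (totalX f) :=
  ((hf.pder_of_commute .x).mono (by omega)).add
    ((hf.vertical (p := 3) fun j : ℕ => (jet (j + 1)).mono (by push_cast; omega)).mono (by omega))

theorem iterate_totalX {k : ℤ} {f : localFun} (hf : WeightLE k f) (n : ℕ) :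
    WeightLE (k + n) (KRRI.totalX^[n] f) := by
  induction n with
  | zero => simpa using hf
  | succ n ih =>
    rw [Function.iterate_succ_apply']
    exact ih.totalX.mono (by push_cast; omega)

theorem evolutionary {k p : ℤ} {f G : localFun} (hf : WeightLE k f) (hG : WeightLE p G) :
    WeightLE (k + p - 2) (evolutionary G f) :=
  hf.vertical fun j : ℕ => (hG.iterate_totalX j).mono (by omega)

end WeightLE

/-- Descending induction on `j`: `∂g/∂u_j` vanishes for large `j`, and the commutator relation
expresses it through `∂g/∂u_(j+1)`. No polynomiality of `g` is assumed. The threshold `J` is needed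
where only the higher derivatives of `D_x g` are controlled. -/
theorem weightLE_pder_of_totalX {k : ℤ} {g : localFun} {J : ℕ}
    (h : ∀ j : ℕ, J ≤ j → WeightLE (k - 3 - j) (pder (.u (j + 1)) (totalX g))) :
    ∀ j : ℕ, J ≤ j → WeightLE (k - 3 - j) (pder (.u j) g) := by
  obtain ⟨n, hn⟩ := exists_pder_u_eq_zero g
  have key : ∀ d j : ℕ, n ≤ j + d → J ≤ j → WeightLE (k - 3 - j) (pder (.u j) g) := by
    intro d
    induction d with
    | zero =>
      intro j hj _
      rw [hn j (by omega)]
      exact .zero _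
    | succ d ih =>
      intro j hj hJ
      have e : pder (.u j) g = pder (.u (j + 1)) (totalX g) - totalX (pder (.u (j + 1)) g) := by
        rw [pder_totalX_succ]
        ring
      rw [e]
      exact (h j hJ).sub ((ih (j + 1) (by omega) (by omega)).totalX.mono (by push_cast; omega))
  exact fun j => key n j (by omega)

theorem WeightLE.pder_of_totalX {k : ℤ} {g : localFun} (h : WeightLE k (KRRI.totalX g)) (j : ℕ) :
    WeightLE (k - 3 - j) (pder (.u j) g) :=
  weightLE_pder_of_totalX (J := 0)
    (fun j _ => (h.pder_u (j + 1)).mono (by push_cast; omega)) j (Nat.zero_le j)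

/-- The maximum with zero accounts for the constants of integration, which have weight zero. -/
theorem WeightLE.of_totalX {k : ℤ} {g : localFun} (h : WeightLE k (KRRI.totalX g)) :
    WeightLE (max (k - 1) 0) g :=
  .of (le_max_right _ _) fun j => (h.pder_of_totalX j).mono (by omega)

theorem pder_eq_zero_of_totalX {k : ℤ} {g : localFun} (h : WeightLE k (totalX g)) (hk : k ≤ 2)
    (j : ℕ) : pder (.u j) g = 0 :=
  (h.pder_of_totalX j).eq_zero_of_neg (by omega)

/-- The cube has weight nine and is invisible to `∂/∂u_j` for `j ≥ 2`, so `∂g/∂u_1` has weight at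
most 4. Comparing the two orders of the mixed derivative in `u_0, u_1` then bounds `6 c u_1`, of
nominal weight 3, by weight 2. -/
theorem eq_zero_of_totalX_eq_cube {g w c : localFun} (hc : ∀ j, pder (.u j) c = 0)
    (hw : WeightLE 8 w) (h : totalX g = c * jet 1 ^ 3 + w) : c = 0 := by
  have h₁ : WeightLE 4 (pder (.u 1) g) := by
    refine weightLE_pder_of_totalX (k := 8) (J := 1) (fun j hj => ?_) 1 le_rfl
    have h0 : pder (.u (j + 1)) (c * jet 1 ^ 3) = 0 := by
      simp only [Derivation.leibniz, Derivation.leibniz_pow, hc, pder_u_jet,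
        if_neg (show j + 1 ≠ 1 by omega), smul_zero, add_zero]
    rw [h, map_add, h0, zero_add]
    exact (hw.pder_u (j + 1)).mono (by push_cast; omega)
  have h₀ : pder (.u 0) g = 3 * c * jet 1 ^ 2 + (pder (.u 1) w - totalX (pder (.u 1) g)) := by
    have e := pder_totalX_succ 0 g
    rw [h, map_add, Derivation.leibniz, Derivation.leibniz_pow] at e
    simp only [hc, pder_u_jet, zero_add, smul_eq_mul, if_true, nsmul_eq_mul] at e
    push_cast at e
    linear_combination -e
  have h₁₀ : WeightLE 2 (6 * c * jet 1) := by
    have e := pder_comm (.u 1) (.u 0) g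
    have h3 : pder (.u 1) (3 * c * jet 1 ^ 2) = 6 * c * jet 1 := by
      have : pder (.u 1) (3 : localFun) = 0 := (pder (.u 1)).map_natCast 3
      simp [Derivation.leibniz, Derivation.leibniz_pow, hc, this]
      ring
    rw [h₀, map_add, h3] at e
    have : 6 * c * jet 1 = pder (.u 0) (pder (.u 1) g) -
        pder (.u 1) (pder (.u 1) w - totalX (pder (.u 1) g)) := by
      rw [← e]
      ring
    rw [this]
    exact ((h₁.pder_u 0).mono (by norm_num)).sub
      ((((hw.pder_u 1).mono (k' := 5) (by norm_num)).sub (h₁.totalX.mono (by norm_num))).pder_u 1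
        |>.mono (by norm_num))
  have h6 : pder (.u 1) (6 * c * jet 1) = 6 * c := by
    have : pder (.u 1) (6 : localFun) = 0 := (pder (.u 1)).map_natCast 6
    simp [Derivation.leibniz, hc, this]
  have := (h₁₀.pder_u 1).eq_zero_of_neg (by norm_num)
  rw [h6] at this
  have e : c = (6 : ℝ)⁻¹ • (6 * c) := by
    have h6c : 6 * c = (6 : ℝ) • c := by
      rw [Algebra.smul_def, map_ofNat]
    rw [h6c, smul_smul]
    norm_num
  rw [e, this, smul_zero]

/-! ### Calculus of leading terms. -/

/-- `f'` has weight at most `k` and agrees with `f` up to terms of lower weight. -/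
def LeadingTerm (k : ℤ) (f f' : localFun) : Prop :=
  WeightLE k f' ∧ WeightLE (k - 1) (f - f')

namespace LeadingTerm

theorem zero (k : ℤ) : LeadingTerm k 0 0 := ⟨.zero _, by rw [sub_zero]; exact .zero _⟩

theorem refl {k : ℤ} {f : localFun} (h : WeightLE k f) : LeadingTerm k f f :=
  ⟨h, by rw [sub_self]; exact .zero _⟩

theorem weightLE {k : ℤ} {f f' : localFun} (h : LeadingTerm k f f') : WeightLE k f := by
  have := (h.2.mono (k' := k) (by omega)).add h.1
  rwa [sub_add_cancel] at this

theorem add {k : ℤ} {f f' g g' : localFun} (hf : LeadingTerm k f f') (hg : LeadingTerm k g g') :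
    LeadingTerm k (f + g) (f' + g') :=
  ⟨hf.1.add hg.1, by rw [add_sub_add_comm]; exact hf.2.add hg.2⟩

theorem smul {k : ℤ} {f f' : localFun} (hf : LeadingTerm k f f') (r : ℝ) :
    LeadingTerm k (r • f) (r • f') :=
  ⟨hf.1.smul r, by rw [← smul_sub]; exact hf.2.smul r⟩

theorem sub {k : ℤ} {f f' g g' : localFun} (hf : LeadingTerm k f f') (hg : LeadingTerm k g g') :
    LeadingTerm k (f - g) (f' - g') := by
  simpa [sub_eq_add_neg] using hf.add (hg.smul (-1))

theorem sum {ι : Type*} {k : ℤ} (s : Finset ι) {f f' : ι → localFun}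
    (h : ∀ i ∈ s, LeadingTerm k (f i) (f' i)) :
    LeadingTerm k (∑ i ∈ s, f i) (∑ i ∈ s, f' i) := by
  induction s using Finset.cons_induction with
  | empty => exact zero k
  | cons a s ha ih =>
    rw [Finset.sum_cons, Finset.sum_cons]
    exact (h a (Finset.mem_cons_self a s)).add
      (ih fun i hi => h i (Finset.mem_cons_of_mem hi))

theorem mul {k m : ℤ} {f f' g g' : localFun} (hf : LeadingTerm k f f')
    (hg : LeadingTerm m g g') : LeadingTerm (k + m) (f * g) (f' * g') := by
  refine ⟨hf.1.mul hg.1, ?_⟩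
  have e : f * g - f' * g' = (f - f') * g + f' * (g - g') := by ring
  rw [e]
  exact ((hf.2.mul hg.weightLE).mono (by omega)).add ((hf.1.mul hg.2).mono (by omega))

theorem totalX {k : ℤ} {f f' : localFun} (hf : LeadingTerm k f f') :
    LeadingTerm (k + 1) (totalX f) (KRRI.totalX f') :=
  ⟨hf.1.totalX, by rw [← map_sub]; exact hf.2.totalX.mono (by omega)⟩

theorem iterate_totalX {k : ℤ} {f f' : localFun} (hf : LeadingTerm k f f') (n : ℕ) :
    LeadingTerm (k + n) (KRRI.totalX^[n] f) (KRRI.totalX^[n] f') := by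
  induction n with
  | zero => simpa using hf
  | succ n ih =>
    rw [Function.iterate_succ_apply', Function.iterate_succ_apply', Nat.cast_succ, ← add_assoc]
    exact ih.totalX

end LeadingTerm

theorem iterate_totalX_sub (n : ℕ) (f g : localFun) :
    totalX^[n] (f - g) = totalX^[n] f - totalX^[n] g := by
  induction n with
  | zero => rfl
  | succ n ih => simp only [Function.iterate_succ_apply', ih, map_sub]

theorem evolutionary_sub (G H f : localFun) :
    evolutionary (G - H) f = evolutionary G f - evolutionary H f := by
  obtain ⟨n, h⟩ := exists_pder_u_eq_zero f
  simp only [evolutionary, vertical_apply_eq_sum _ _ h, iterate_totalX_sub, sub_mul,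
    Finset.sum_sub_distrib]

/-- Explicit `∂/∂t` keeps the weight, while the evolutionary part raises it by `p - 2`. For `p ≥ 3`
the former is therefore of lower order. -/
theorem LeadingTerm.totalT {k p : ℤ} {f f' G G' : localFun} (hf : LeadingTerm k f f')
    (hG : LeadingTerm p G G') (hp : 3 ≤ p) :
    LeadingTerm (k + p - 2) (totalT G f) (evolutionary G' f') := by
  refine ⟨hf.1.evolutionary hG.1, ?_⟩
  have e : KRRI.totalT G f - evolutionary G' f' =
      pder .t f + (evolutionary (G - G') f + evolutionary G' (f - f')) := by
    rw [evolutionary_sub, map_sub, KRRI.totalT, Derivation.add_apply]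
    ring
  rw [e]
  exact ((hf.weightLE.pder_of_commute .t).mono (by omega)).add
    (((hf.weightLE.evolutionary hG.2).mono (by omega)).add
      ((hf.2.evolutionary hG.1).mono (by omega)))

/-! ### Degrees, products of series and the coefficients of the symplectic condition. -/

theorem deg_le_of_forall_lt {L : Series} {p : ℤ} (h : ∀ i, p < i → L i = 0) :
    deg L ≤ (p : WithBot ℤ) := by
  unfold deg
  split_ifs with h0
  · exact bot_le
  · obtain ⟨i, hi⟩ := Function.ne_iff.mp h0
    exact WithBot.coe_le_coe.mpr (csSup_le ⟨i, hi⟩ fun j hj => not_lt.mp fun hlt => hj (h j hlt))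

theorem le_deg {L : Series} {p m : ℤ} (h : ∀ i, p < i → L i = 0) (hm : L m ≠ 0) :
    (m : WithBot ℤ) ≤ deg L := by
  unfold deg
  rw [if_neg fun h0 => hm (congrFun h0 m)]
  exact WithBot.coe_le_coe.mpr
    (le_csSup ⟨p, fun j hj => not_lt.mp fun hlt => hj (h j hlt)⟩ hm)

theorem IsFormalSeries.exists_leading {L : Series} (hL : IsFormalSeries L) (h0 : L ≠ 0) :
    ∃ n, L n ≠ 0 ∧ ∀ i, n < i → L i = 0 := by
  obtain ⟨-, p, hp⟩ := hL
  obtain ⟨i, hi⟩ := Function.ne_iff.mp h0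
  have hb : BddAbove {i : ℤ | L i ≠ 0} := ⟨p, fun j hj => not_lt.mp fun hlt => hj (hp j hlt)⟩
  refine ⟨sSup {i : ℤ | L i ≠ 0}, Int.csSup_mem ⟨i, hi⟩ hb, fun j hj => ?_⟩
  by_contra hne
  exact absurd (le_csSup hb hne) (not_le.mpr hj)

theorem iterate_totalX_zero (k : ℕ) : totalX^[k] 0 = 0 := by
  induction k with
  | zero => rfl
  | succ k ih => rw [Function.iterate_succ_apply', ih, map_zero]

theorem comp_eq_coe_sum (A B : ℤ → localFun) (m : ℤ) (S : Finset (ℤ × ℕ))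
    (hS : ∀ p ∉ S, A p.1 = 0 ∨ Ring.choose p.1 p.2 = 0 ∨ B (m - p.1 + p.2) = 0) :
    comp (fun i => A i) (fun i => B i) m =
      ((∑ p ∈ S, ((Ring.choose p.1 p.2 : ℤ) : ℝ) •
        (A p.1 * totalX^[p.2] (B (m - p.1 + p.2))) : localFun) : JetFun) := by
  funext t x u
  rw [coe_sum_apply]
  unfold comp
  rw [finsum_eq_sum_of_support_subset (s := S)]
  · refine Finset.sum_congr rfl fun p _ => ?_
    rw [← coe_totalX_iterate]
    change _ = (_ : ℝ) * ((_ : ℝ) * (_ : ℝ))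
    ring
  · intro p hp
    by_contra hpS
    apply hp
    beta_reduce
    rw [← coe_totalX_iterate]
    rcases hS p hpS with h | h | h <;> simp [h]

/-- The coefficients of the linearization. -/
def linCoeff (F : localFun) (i : ℤ) : localFun :=
  if 0 ≤ i then pder (.u i.toNat) F else 0

theorem linearization_eq (F : localFun) :
    linearization F = fun i => (linCoeff F i : JetFun) := by
  funext i
  unfold linearization linCoeff
  split_ifs <;> rfl

theorem linCoeff_natCast (F : localFun) (i : ℕ) : linCoeff F i = pder (.u i) F := by
  simp [linCoeff]

theorem linCoeff_eq_zero {F : localFun} (hF : ∀ j, 5 < j → pder (.u j) F = 0) {i : ℤ}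
    (hi : i < 0 ∨ 5 < i) : linCoeff F i = 0 := by
  unfold linCoeff
  split_ifs
  · exact hF _ (by omega)
  · rfl

/-- The coefficient at `D ^ i` of the adjoint of the linearization. -/
def adjCoeff (F : localFun) (i : ℤ) : localFun :=
  if 0 ≤ i then ∑ k ∈ Finset.range 6,
    ((-1) ^ (i.toNat + k) * ((i.toNat + k).choose k : ℝ)) •
      totalX^[k] (pder (.u (i.toNat + k)) F)
  else 0

theorem adjCoeff_eq_zero {F : localFun} (hF : ∀ j, 5 < j → pder (.u j) F = 0) {i : ℤ}
    (hi : i < 0 ∨ 5 < i) : adjCoeff F i = 0 := by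
  unfold adjCoeff
  split_ifs
  · refine Finset.sum_eq_zero fun k _ => ?_
    rw [hF _ (by omega), iterate_totalX_zero, smul_zero]
  · rfl

theorem adjoint_eq {F : localFun} (hF : ∀ j, 5 < j → pder (.u j) F = 0) :
    adjoint (linearization F) = fun i => (adjCoeff F i : JetFun) := by
  funext i t x u
  unfold adjoint
  rw [linearization_eq]
  unfold adjCoeff
  split_ifs with hi
  · lift i to ℕ using hi
    rw [coe_sum_apply, finsum_eq_sum_of_support_subset (s := Finset.range 6)]
    · refine Finset.sum_congr rfl fun k _ => ?_
      rw [← coe_totalX_iterate]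
      rw [← Nat.cast_add, linCoeff_natCast, zpow_natCast, Ring.choose_natCast]
      simp only [Int.toNat_natCast, Int.cast_natCast]
      rfl
    · intro k hk
      by_contra hkS
      simp only [Finset.coe_range, Set.mem_Iio, not_lt] at hkS
      apply hk
      simp only
      rw [← coe_totalX_iterate, linCoeff_eq_zero hF (Or.inr (by omega)), iterate_totalX_zero]
      simp
  · rw [finsum_eq_zero_of_forall_eq_zero]
    · rfl
    · intro k
      by_cases hk : 0 ≤ i + k
      · obtain ⟨r, hr⟩ := Int.eq_ofNat_of_zero_le hk
        rw [hr, Ring.choose_natCast, Nat.choose_eq_zero_of_lt (by omega)]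
        simp
      · rw [← coe_totalX_iterate, linCoeff_eq_zero hF (Or.inl (by omega)), iterate_totalX_zero]
        simp

/-- The coefficient at `D ^ (n + 5 - s)` of `D_t(L) + F_*† ∘ L + L ∘ F_*` for a series
`L = ∑ l_q D ^ (n - q)` and an equation of order at most five, when `s ≤ 9`. -/
def residual (F : localFun) (n : ℤ) (l : ℤ → localFun) (s : ℤ) : localFun :=
  totalT F (l (s - 5)) +
    ∑ i ∈ Finset.range 6, ∑ k ∈ Finset.range 6,
      (i.choose k : ℝ) • (adjCoeff F i * totalX^[k] (l (s - 5 + i - k))) +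
    ∑ i ∈ Finset.range 6, ∑ k ∈ Finset.range 10,
      ((Ring.choose (n - (s - 5 + i - k)) k : ℤ) : ℝ) •
        (l (s - 5 + i - k) * totalX^[k] (pder (.u i) F))

theorem residual_eq_zero_of_neg (F : localFun) (n : ℤ) {l : ℤ → localFun}
    (hl : ∀ q, q < 0 → l q = 0) {s : ℤ} (hs : s < 0) : residual F n l s = 0 := by
  have h1 : ∀ i ∈ Finset.range 6, ∀ k : ℕ, l (s - 5 + i - k) = 0 := fun i hi k => by
    have := Finset.mem_range.mp hi
    exact hl _ (by omega)
  unfold residual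
  rw [hl _ (show s - 5 < 0 by omega), map_zero, zero_add, Finset.sum_eq_zero, zero_add,
    Finset.sum_eq_zero]
  · intro i hi
    refine Finset.sum_eq_zero fun k _ => ?_
    rw [h1 i hi, zero_mul, smul_zero]
  · intro i hi
    refine Finset.sum_eq_zero fun k _ => ?_
    rw [h1 i hi, iterate_totalX_zero, mul_zero, smul_zero]

theorem comp_adjoint_eq {F : localFun} (hF : ∀ j, 5 < j → pder (.u j) F = 0) (n : ℤ)
    (l : ℤ → localFun) (s : ℤ) :
    comp (adjoint (linearization F)) (fun i => (l (n - i) : JetFun)) (n + 5 - s) =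
      ((∑ i ∈ Finset.range 6, ∑ k ∈ Finset.range 6,
        (i.choose k : ℝ) • (adjCoeff F i * totalX^[k] (l (s - 5 + i - k))) : localFun) :
        JetFun) := by
  rw [adjoint_eq hF, ← Finset.sum_product']
  have hinj : Set.InjOn (fun p : ℕ × ℕ => ((p.1 : ℤ), p.2))
      (Finset.range 6 ×ˢ Finset.range 6 : Finset (ℕ × ℕ)) := by
    rintro ⟨i, k⟩ _ ⟨i', k'⟩ _ h
    simpa using h
  rw [comp_eq_coe_sum (adjCoeff F) (fun i => l (n - i)) _
    ((Finset.range 6 ×ˢ Finset.range 6).image fun p : ℕ × ℕ => ((p.1 : ℤ), p.2)),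
    Finset.sum_image hinj]
  · refine congrArg _ (Finset.sum_congr rfl fun p _ => ?_)
    rw [Ring.choose_natCast, Int.cast_natCast]
    congr 4
    omega
  · rintro ⟨i, k⟩ h
    by_cases hi : i < 0 ∨ 5 < i
    · exact Or.inl (adjCoeff_eq_zero hF hi)
    · lift i to ℕ using by omega
      refine Or.inr (Or.inl ?_)
      rw [Ring.choose_natCast, Nat.choose_eq_zero_of_lt, Nat.cast_zero]
      by_contra hk
      apply h
      simp only [Finset.mem_image, Finset.mem_product, Finset.mem_range]
      exact ⟨(i, k), by omega, rfl⟩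

/-- Nonzero terms need `k ≤ s - 5 + i`, which is at most 9 when `s ≤ 9` and `i ≤ 5`; hence `range
10`. -/
theorem comp_linearization_eq {F : localFun} (hF : ∀ j, 5 < j → pder (.u j) F = 0) (n : ℤ)
    {l : ℤ → localFun} (hl : ∀ q, q < 0 → l q = 0) {s : ℤ} (hs : s ≤ 9) :
    comp (fun i => (l (n - i) : JetFun)) (linearization F) (n + 5 - s) =
      ((∑ i ∈ Finset.range 6, ∑ k ∈ Finset.range 10,
        ((Ring.choose (n - (s - 5 + i - k)) k : ℤ) : ℝ) •
          (l (s - 5 + i - k) * totalX^[k] (pder (.u i) F)) : localFun) : JetFun) := by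
  rw [linearization_eq, ← Finset.sum_product']
  have hinj : Set.InjOn (fun p : ℕ × ℕ => (n - (s - 5 + p.1 - p.2), p.2))
      (Finset.range 6 ×ˢ Finset.range 10 : Finset (ℕ × ℕ)) := by
    rintro ⟨i, k⟩ _ ⟨i', k'⟩ _ h
    simp only [Prod.mk.injEq] at h ⊢
    omega
  rw [comp_eq_coe_sum (fun i => l (n - i)) (linCoeff F) _
    ((Finset.range 6 ×ˢ Finset.range 10).image
      fun p : ℕ × ℕ => (n - (s - 5 + p.1 - p.2), p.2)), Finset.sum_image hinj]
  · refine congrArg _ (Finset.sum_congr rfl fun p _ => ?_)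
    simp only [sub_sub_cancel]
    congr 3
    rw [← linCoeff_natCast]
    congr 1
    omega
  · rintro ⟨i, k⟩ h
    by_cases hi : n < i
    · exact Or.inl (hl _ (by omega))
    · refine Or.inr (Or.inr (linCoeff_eq_zero hF ?_))
      by_contra hk
      apply h
      simp only [Finset.mem_image, Finset.mem_product, Finset.mem_range, Prod.mk.injEq] at hk ⊢
      exact ⟨((n + 5 - s - i + k).toNat, k), by omega, by omega, rfl⟩

theorem IsFormalSymplecticOperator.exists_residual_eq_zero {F : localFun}
    (hF : ∀ j, 5 < j → pder (.u j) F = 0) {L : Series} {r : ℤ}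
    (hL : IsFormalSymplecticOperator F L r) :
    ∃ (n : ℤ) (l : ℤ → localFun), l 0 ≠ 0 ∧ (∀ q, q < 0 → l q = 0) ∧
      ∀ s : ℤ, s ≤ 9 → s < r → residual F n l s = 0 := by
  obtain ⟨hS, h0, hdeg⟩ := hL
  obtain ⟨n, hn, hlt⟩ := hS.exists_leading h0
  let l : ℤ → localFun := fun q => ⟨L (n - q), hS.1 _⟩
  have hl : ∀ q, q < 0 → l q = 0 := fun q hq => Subtype.ext (hlt _ (by omega))
  have hLl : L = fun i => (l (n - i) : JetFun) := by
    funext i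
    simp [l]
  refine ⟨n, l, fun h => hn ?_, hl, ?_⟩
  · simpa [l] using congrArg Subtype.val h
  set R := DtSeries F L + comp (adjoint (linearization F)) L + comp L (linearization F) with hR
  have hcoef : ∀ s : ℤ, s ≤ 9 → R (n + 5 - s) = (residual F n l s : JetFun) := by
    intro s hs
    have e : DtSeries F L (n + 5 - s) = (totalT F (l (s - 5)) : JetFun) := by
      rw [coe_totalT, DtSeries]
      congr 1
      change L _ = L _
      congr 1
      omega
    rw [hR, Pi.add_apply, Pi.add_apply, e, hLl, comp_adjoint_eq hF,
      comp_linearization_eq hF n hl hs]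
    rfl
  -- Boundedness above is required before `deg R` can be used: on an unbounded set of integers
  -- `sSup` takes a default value.
  have hRtop : ∀ i, n + 5 < i → R i = 0 := by
    intro i hi
    have := hcoef (n + 5 - i) (by omega)
    rw [residual_eq_zero_of_neg F n hl (by omega), sub_sub_cancel] at this
    exact this
  intro s hs hr
  by_contra hne
  have h1 : ((n + 5 - s : ℤ) : WithBot ℤ) ≤ deg R :=
    le_deg hRtop fun h => hne (Subtype.ext ((hcoef s hs).symm.trans h))
  have h2 : deg L ≤ (n : WithBot ℤ) := deg_le_of_forall_lt hlt
  have h3 : deg (linearization F) ≤ ((5 : ℤ) : WithBot ℤ) := by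
    refine deg_le_of_forall_lt fun i hi => ?_
    rw [linearization_eq]
    exact congrArg Subtype.val (linCoeff_eq_zero hF (Or.inr hi))
  have h4 : ((n + 5 - s : ℤ) : WithBot ℤ) + (r : WithBot ℤ) ≤
      (n : WithBot ℤ) + ((5 : ℤ) : WithBot ℤ) :=
    (add_le_add_left h1 _).trans (hdeg.trans (add_le_add h2 h3))
  rw [← WithBot.coe_add, ← WithBot.coe_add, WithBot.coe_le_coe] at h4
  omega

/-! ### Universal identities in an abstract differential algebra. -/

section LeadingPart

variable {A : Type*} [CommRing A] [Algebra ℝ A]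

/-- The falling factorial `x (x - 1) ⋯ (x - k + 1)` divided by `k!`. -/
def realChoose (x : ℝ) : ℕ → ℝ
  | 0 => 1
  | k + 1 => realChoose x k * (x - k) / (k + 1)

/-- The terms of the residual of a fifth-order operator with coefficients `c, 0, f 3, …, f 0` that
do not involve the two highest unknown coefficients `l s` and `l (s - 1)`. -/
def lowerResidual (c : ℝ) (δ D : A → A) (f : ℕ → A) (ν : ℝ) (l : ℤ → A) (s : ℤ) : A :=
  D (l (s - 5)) -
    ∑ k ∈ Finset.range 4, (c * (Nat.choose 5 (k + 2) : ℝ)) • δ^[k + 2] (l (s - (k + 2 : ℕ))) +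
    ∑ i ∈ Finset.range 4, ∑ k ∈ Finset.range 4, (i.choose k : ℝ) •
      ((∑ j ∈ Finset.range 4, ((-1) ^ (i + j) * ((i + j).choose j : ℝ)) • δ^[j] (f (i + j))) *
        δ^[k] (l (s - 5 + i - k))) +
    ∑ i ∈ Finset.range 4, ∑ k ∈ Finset.range 10,
      realChoose (ν - ((s - 5 + i - k : ℤ) : ℝ)) k • (l (s - 5 + i - k) * δ^[k] (f i))

/-- Coefficients of the weight-homogeneous series that satisfies the symplectic condition for
`v_t = 3/8 v² v₁ - 23/24 v₁ v₂ - 5/12 v v₃ - 19/360 v₅` up to order eight. -/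
def leadingCoeff (ν : ℝ) (v : ℕ → A) : ℤ → A
  | 0 => 1
  | 2 => ((30 * ν + 48) / 19) • v 0
  | 3 => ((15 * ν ^ 2 - 6 * ν - 48) / 19) • v 1
  | 4 => ((10 * ν ^ 3 - 21 * ν ^ 2 - 7 * ν + 60) / 38) • v 2 +
      ((450 * ν ^ 2 - 1323 * ν - 2961) / 361) • (v 0 * v 0)
  | 5 => ((5 * ν ^ 4 - 24 * ν ^ 3 + 19 * ν ^ 2 - 48) / 76) • v 3 +
      ((450 * ν ^ 3 - 3123 * ν ^ 2 + 2331 * ν + 11844) / 361) • (v 0 * v 1)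
  | 6 => ((2 * ν ^ 5 - 17 * ν ^ 4 + 40 * ν ^ 3 - 31 * ν ^ 2 + 78 * ν + 96) / 152) • v 4 +
      ((150 * ν ^ 4 - 1596 * ν ^ 3 + 4332 * ν ^ 2 + 2298 * ν - 11232) / 361) • (v 0 * v 2) +
      ((225 * ν ^ 4 - 2922 * ν ^ 3 + 8838 * ν ^ 2 + 3921 * ν - 24156) / 722) • (v 1 * v 1) +
      ((4500 * ν ^ 3 - 61290 * ν ^ 2 + 75366 * ν + 265140) / 6859) • (v 0 * v 0 * v 0)
  | 7 => ((5 * ν ^ 6 - 66 * ν ^ 5 + 290 * ν ^ 4 - 540 * ν ^ 3 + 965 * ν ^ 2 - 1734 * ν - 3600) / 2280) • v 5 +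
      ((150 * ν ^ 5 - 2301 * ν ^ 4 + 11088 * ν ^ 3 - 11559 * ν ^ 2 - 29922 * ν + 16344) / 1444) • (v 0 * v 3) +
      ((300 * ν ^ 5 - 5463 * ν ^ 4 + 30372 * ν ^ 3 - 38115 * ν ^ 2 - 85050 * ν + 69336) / 1444) • (v 1 * v 2) +
      ((6750 * ν ^ 4 - 132435 * ν ^ 3 + 664659 * ν ^ 2 - 280584 * ν - 2386260) / 6859) • (v 0 * v 0 * v 1)
  | 8 => ((10 * ν ^ 7 - 189 * ν ^ 6 + 1309 * ν ^ 5 - 4305 * ν ^ 4 + 9625 * ν ^ 3 - 20706 * ν ^ 2 + 14256 * ν + 80640) / 31920) • v 6 +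
      ((75 * ν ^ 6 - 1578 * ν ^ 5 + 11700 * ν ^ 4 - 31560 * ν ^ 3 - 255 * ν ^ 2 + 86058 * ν + 14400) / 3610) • (v 0 * v 4) +
      ((375 * ν ^ 6 - 9084 * ν ^ 5 + 75780 * ν ^ 4 - 227340 * ν ^ 3 + 12495 * ν ^ 2 + 727554 * ν + 161640) / 7220) • (v 1 * v 3) +
      ((500 * ν ^ 6 - 12426 * ν ^ 5 + 106445 * ν ^ 4 - 329880 * ν ^ 3 + 37955 * ν ^ 2 + 1030806 * ν + 158040) / 14440) • (v 2 * v 2) +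
      ((4500 * ν ^ 5 - 113940 * ν ^ 4 + 920367 * ν ^ 3 - 2395710 * ν ^ 2 - 1082493 * ν + 7275528) / 13718) • (v 0 * v 0 * v 2) +
      ((3375 * ν ^ 5 - 93375 * ν ^ 4 + 818685 * ν ^ 3 - 2361546 * ν ^ 2 - 559296 * ν + 7633737) / 6859) • (v 0 * v 1 * v 1) +
      ((67500 * ν ^ 4 - 2054700 * ν ^ 3 + 14821029 * ν ^ 2 - 11688570 * ν - 57850119) / 260642) • (v 0 * v 0 * v 0 * v 0)
  | _ => 0

/-- The coefficients of the linearization of `β (3/8 v² v₁ - 23/24 v₁ v₂ - 5/12 v v₃)`. -/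
def leadingLin (β : ℝ) (v : ℕ → A) : ℕ → A
  | 0 => (β * (3 / 4)) • (v 0 * v 1) - (β * (5 / 12)) • v 3
  | 1 => (β * (3 / 8)) • (v 0 * v 0) - (β * (23 / 24)) • v 2
  | 2 => -(β * (23 / 24)) • v 1
  | 3 => -(β * (5 / 12)) • v 0
  | _ => 0

variable {β : ℝ} {v : ℕ → A} {δ D : Derivation ℝ A A}

set_option maxHeartbeats 4000000 in
-- Each `leadingCoeff ν v (s - 1)` was chosen as an antiderivative for equation `s`; what remains is
-- a polynomial identity in `ν` and the `v j`.
theorem lowerResidual_leadingCoeff (ν : ℝ) (hv : ∀ j, δ (v j) = v (j + 1))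
    (hD : ∀ j, D (v j) = δ^[j] ((β * (3 / 8)) • (v 0 * v 0 * v 1) - (β * (23 / 24)) • (v 1 * v 2) -
      (β * (5 / 12)) • (v 0 * v 3) - (β * (19 / 360)) • v 5)) {s : ℤ} (h2 : 2 ≤ s) (h8 : s ≤ 8) :
    lowerResidual (-(β * (19 / 360))) δ D (leadingLin β v) ν (leadingCoeff ν v) s =
      (5 * -(β * (19 / 360))) • δ (leadingCoeff ν v (s - 1)) := by
  interval_cases s <;>
    simp [lowerResidual, Finset.sum_range_succ, leadingCoeff, leadingLin, hv, hD,
      Derivation.leibniz, realChoose, Nat.choose] <;>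
    algebra

set_option maxHeartbeats 4000000 in
-- Here the integration breaks down: `leadingCoeff ν v 8` absorbs everything except the cubic term,
-- which is the obstruction.
theorem lowerResidual_leadingCoeff_nine (ν : ℝ) (hv : ∀ j, δ (v j) = v (j + 1))
    (hD : ∀ j, D (v j) = δ^[j] ((β * (3 / 8)) • (v 0 * v 0 * v 1) - (β * (23 / 24)) • (v 1 * v 2) -
      (β * (5 / 12)) • (v 0 * v 3) - (β * (19 / 360)) • v 5)) :
    lowerResidual (-(β * (19 / 360))) δ D (leadingLin β v) ν (leadingCoeff ν v) 9 =
      (5 * -(β * (19 / 360))) • (δ (leadingCoeff ν v 8) +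
        ((12717 * ν + 67797) / 6859) • (v 1 * v 1 * v 1)) := by
  simp [lowerResidual, Finset.sum_range_succ, leadingCoeff, leadingLin, hv, hD,
    Derivation.leibniz, realChoose, Nat.choose]
  algebra

end LeadingPart

section SubleadingPart

variable {A : Type*} [CommRing A] [Algebra ℝ A]

/-- The coefficients `f 3 = β p`, `f 2 = β δ q`, `f 1 = β r`, `f 0 = β δ w` of a third-order
operator. -/
def exactLin (β : ℝ) (p q r w : ℕ → A) : ℕ → A
  | 0 => β • w 1
  | 1 => β • r 0
  | 2 => β • q 1
  | 3 => β • p 0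
  | _ => 0

set_option maxHeartbeats 4000000 in
-- Because the coefficients at `D^2` and `D^0` are exact, the equations `s ≤ 4` integrate
-- explicitly, with constants `l 0`, `l 1`, `c2`, `c3`. The equation `s = 5` is the first to contain
-- `D (l 0)`, and all its other terms except `p q'` integrate too.
theorem exists_potential {δ D : Derivation ℝ A A} {β ν : ℝ} (hβ : β ≠ 0) {p q r w : ℕ → A}
    (hp : ∀ j, δ (p j) = p (j + 1)) (hq : ∀ j, δ (q j) = q (j + 1))
    (hr : ∀ j, δ (r j) = r (j + 1)) (hw : ∀ j, δ (w j) = w (j + 1)) {l : ℤ → A}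
    (hl : ∀ i, i < 0 → l i = 0)
    (hE : ∀ s : ℤ, 1 ≤ s → s ≤ 5 →
      lowerResidual (β / 5) δ D (exactLin β p q r w) ν l s = β • δ (l (s - 1))) :
    ∃ g, δ g = D (l 0) - (2 * β) • (l 0 * (p 0 * q 1)) := by
  have cancel : ∀ y : A, β • y = 0 → y = 0 := fun y hy => by
    simpa [smul_smul, hβ] using congrArg (β⁻¹ • ·) hy
  have d0 : δ (l 0) = 0 := by
    refine cancel _ ((hE 1 (by norm_num) (by norm_num)).symm.trans ?_)
    simp [lowerResidual, Finset.sum_range_succ, exactLin, hl]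
  have d1 : δ (l 1) = 0 := by
    refine cancel _ ((hE 2 (by norm_num) (by norm_num)).symm.trans ?_)
    simp [lowerResidual, Finset.sum_range_succ, exactLin, hl, d0, realChoose, Nat.choose]
    algebra
  obtain ⟨c2, e2, d2⟩ : ∃ c2, l 2 = c2 + l 0 * ((ν - 3) • p 0 + (2 : ℝ) • q 0) ∧ δ c2 = 0 := by
    refine ⟨_, (sub_add_cancel _ _).symm, cancel _ ?_⟩
    have h3 : β • δ (l 2) = _ := (hE 3 (by norm_num) (by norm_num)).symm
    rw [map_sub, smul_sub, h3]
    simp [lowerResidual, Finset.sum_range_succ, exactLin, hl, d0, d1, hp, hq, Derivation.leibniz,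
      realChoose, Nat.choose]
    algebra
  obtain ⟨c3, e3, d3⟩ : ∃ c3, l 3 = c3 + l 1 * ((ν - 4) • p 0 + (2 : ℝ) • q 0) +
      l 0 * (((ν ^ 2 - 5 * ν + 6) / 2) • p 1 + (ν - 2) • q 1) ∧ δ c3 = 0 := by
    refine ⟨l 3 - l 1 * ((ν - 4) • p 0 + (2 : ℝ) • q 0) -
      l 0 * (((ν ^ 2 - 5 * ν + 6) / 2) • p 1 + (ν - 2) • q 1), by ring, cancel _ ?_⟩
    have h4 : β • δ (l 3) = _ := (hE 4 (by norm_num) (by norm_num)).symm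
    rw [map_sub, map_sub, smul_sub, smul_sub, h4]
    simp [lowerResidual, Finset.sum_range_succ, exactLin, hl, d0, d1, d2, e2, hp, hq,
      Derivation.leibniz, realChoose, Nat.choose]
    algebra
  refine ⟨β • (l 4 - (c2 * ((ν - 5) • p 0 + (2 : ℝ) • q 0) +
    l 1 * (((ν ^ 2 - 7 * ν + 12) / 2) • p 1 + (ν - 3) • q 1) +
    l 0 * (((ν ^ 3 - 9 * ν ^ 2 + 20 * ν - 6) / 6) • p 2 + ((ν ^ 2 - 5 * ν + 2) / 2) • q 2 +
      (2 : ℝ) • w 0 + (ν - 1) • r 0 + (2 : ℝ) • (q 0 * q 0) +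
      ((ν ^ 2 - 11 * ν + 24) / 2) • (p 0 * p 0) + (2 * ν - 10) • (p 0 * q 0)))), ?_⟩
  have h5 : β • δ (l 4) = _ := (hE 5 (by norm_num) (by norm_num)).symm
  rw [Derivation.map_smul, map_sub, smul_sub, h5]
  simp [lowerResidual, Finset.sum_range_succ, exactLin, hl, d0, d1, d2, d3, e2, e3, hp, hq, hr, hw,
    Derivation.leibniz, realChoose, Nat.choose]
  algebra

end SubleadingPart

/-! ### Reduction of the residual to `lowerResidual`. -/

theorem descPochhammer_smeval_eq (x : ℝ) (k : ℕ) :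
    (descPochhammer ℤ k).smeval x = k.factorial * realChoose x k := by
  induction k with
  | zero => simp [realChoose]
  | succ k ih =>
    rw [descPochhammer_succ_right, Polynomial.smeval_mul, ih, Polynomial.smeval_sub,
      Polynomial.smeval_X, Polynomial.smeval_natCast, realChoose, Nat.factorial_succ]
    push_cast
    field_simp
    simp

theorem cast_ringChoose (p : ℤ) (k : ℕ) :
    ((Ring.choose p k : ℤ) : ℝ) = realChoose p k := by
  have h := Ring.map_choose (Int.castRingHom ℝ) p k
  simp only [Int.coe_castRingHom] at h
  rw [h, Ring.choose_eq_smul, descPochhammer_smeval_eq, smul_eq_mul, inv_mul_cancel_left₀]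
  positivity

/-- The coefficients below `D ^ 4` of the linearization. -/
def lowLin (F : localFun) (i : ℕ) : localFun := if i < 4 then pder (.u i) F else 0

theorem iterate_totalX_algebraMap (k : ℕ) (r : ℝ) :
    totalX^[k + 1] (algebraMap ℝ localFun r) = 0 := by
  rw [Function.iterate_succ_apply, Derivation.map_algebraMap, iterate_totalX_zero]

section Residual

variable {F : localFun} {c : ℝ}

theorem adjCoeff_of_lt_four (h4 : pder (.u 4) F = 0) (h5 : pder (.u 5) F = algebraMap ℝ _ c)
    (hF : ∀ j, 5 < j → pder (.u j) F = 0) {i : ℕ} (hi : i < 4) :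
    adjCoeff F i = ∑ j ∈ Finset.range 4,
      ((-1) ^ (i + j) * ((i + j).choose j : ℝ)) • totalX^[j] (lowLin F (i + j)) := by
  have e : ∀ j, totalX^[j] (pder (.u (i + j)) F) = totalX^[j] (lowLin F (i + j)) := by
    intro j
    unfold lowLin
    split_ifs with h
    · rfl
    · rw [iterate_totalX_zero]
      rcases (by omega : i + j = 4 ∨ i + j = 5 ∨ 5 < i + j) with h | h | h
      · rw [h, h4, iterate_totalX_zero]
      · obtain ⟨k, rfl⟩ : ∃ k, j = k + 1 := ⟨j - 1, by omega⟩
        rw [h, h5, iterate_totalX_algebraMap]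
      · rw [hF _ h, iterate_totalX_zero]
  rw [adjCoeff, if_pos (Int.natCast_nonneg i)]
  simp only [Int.toNat_natCast, e]
  rw [Finset.sum_range_succ, Finset.sum_range_succ, lowLin, lowLin, if_neg (by omega),
    if_neg (by omega)]
  simp only [iterate_totalX_zero, smul_zero, add_zero]

theorem adjCoeff_four (h4 : pder (.u 4) F = 0) (h5 : pder (.u 5) F = algebraMap ℝ _ c)
    (hF : ∀ j, 5 < j → pder (.u j) F = 0) : adjCoeff F (4 : ℕ) = 0 := by
  rw [adjCoeff, if_pos (Int.natCast_nonneg 4)]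
  simp [Finset.sum_range_succ, h4, h5, hF]

theorem adjCoeff_five (h5 : pder (.u 5) F = algebraMap ℝ _ c)
    (hF : ∀ j, 5 < j → pder (.u j) F = 0) : adjCoeff F (5 : ℕ) = algebraMap ℝ _ (-c) := by
  rw [adjCoeff, if_pos (Int.natCast_nonneg 5)]
  simp [Finset.sum_range_succ, h5, hF]
  norm_num

/-- The adjoint of `c D^5` is `-c D^5`, so the two occurrences of `c l_s` cancel; the next Leibniz
term leaves `-5 c D_x l_(s-1)`. -/
theorem residual_eq (h4 : pder (.u 4) F = 0) (h5 : pder (.u 5) F = algebraMap ℝ _ c)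
    (hF : ∀ j, 5 < j → pder (.u j) F = 0) (n : ℤ) (l : ℤ → localFun) (s : ℤ) :
    residual F n l s =
      lowerResidual c totalX (totalT F) (lowLin F) n l s - (5 * c) • totalX (l (s - 1)) := by
  have e5 : ∀ k : ℕ, l (s - 5 + (5 : ℕ) - k) = l (s - k) := fun k => by
    congr 1
    push_cast
    ring
  have hA : ∑ k ∈ Finset.range 6, (Nat.choose 5 k : ℝ) •
      (adjCoeff F (5 : ℕ) * totalX^[k] (l (s - 5 + (5 : ℕ) - k))) =
      -∑ k ∈ Finset.range 4, (c * (Nat.choose 5 (k + 2) : ℝ)) •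
        totalX^[k + 2] (l (s - (k + 2 : ℕ))) - (5 * c) • totalX (l (s - 1)) - c • l s := by
    simp only [e5]
    rw [adjCoeff_five h5 hF, Finset.sum_range_succ', Finset.sum_range_succ']
    have e : ∀ (r : ℝ) (y : localFun), r • (algebraMap ℝ localFun (-c) * y) = -((c * r) • y) :=
      fun r y => by rw [← Algebra.smul_def, smul_smul, ← neg_smul, mul_neg, mul_comm]
    simp only [e, Finset.sum_neg_distrib]
    have h0 : ((Nat.choose 5 0 : ℕ) : ℝ) = 1 := by norm_num
    have h1 : ((Nat.choose 5 (0 + 1) : ℕ) : ℝ) = 5 := by norm_num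
    simp only [h0, h1, mul_one, mul_comm c 5, Nat.cast_zero, sub_zero, zero_add, Nat.cast_one,
      Function.iterate_one, Function.iterate_zero, id_eq]
    rw [sub_eq_add_neg (_ - _), sub_eq_add_neg (-_)]
  have hB : ∑ k ∈ Finset.range 10, ((Ring.choose (n - (s - 5 + (5 : ℕ) - k)) k : ℤ) : ℝ) •
      (l (s - 5 + (5 : ℕ) - k) * totalX^[k] (pder (.u 5) F)) = c • l s := by
    simp only [e5]
    rw [h5, Finset.sum_range_succ']
    simp only [iterate_totalX_algebraMap, mul_zero, smul_zero, Finset.sum_const_zero]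
    simp [Algebra.smul_def, mul_comm]
  have hlow : ∀ i ∈ Finset.range 4, pder (.u i) F = lowLin F i := fun i hi => by
    rw [lowLin, if_pos (Finset.mem_range.mp hi)]
  have hC : ∑ i ∈ Finset.range 4, ∑ k ∈ Finset.range 6,
      (i.choose k : ℝ) • (adjCoeff F i * totalX^[k] (l (s - 5 + i - k))) =
      ∑ i ∈ Finset.range 4, ∑ k ∈ Finset.range 4, (i.choose k : ℝ) •
      ((∑ j ∈ Finset.range 4, ((-1) ^ (i + j) * ((i + j).choose j : ℝ)) •
        totalX^[j] (lowLin F (i + j))) * totalX^[k] (l (s - 5 + i - k))) := by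
    refine Finset.sum_congr rfl fun i hi => ?_
    have hi := Finset.mem_range.mp hi
    rw [Finset.sum_range_succ, Finset.sum_range_succ, Nat.choose_eq_zero_of_lt (by omega),
      Nat.choose_eq_zero_of_lt (by omega), adjCoeff_of_lt_four h4 h5 hF hi]
    simp
  have hD : ∑ i ∈ Finset.range 4, ∑ k ∈ Finset.range 10,
      ((Ring.choose (n - (s - 5 + i - k)) k : ℤ) : ℝ) •
        (l (s - 5 + i - k) * totalX^[k] (pder (.u i) F)) =
      ∑ i ∈ Finset.range 4, ∑ k ∈ Finset.range 10,
        realChoose ((n : ℝ) - ((s - 5 + i - k : ℤ) : ℝ)) k •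
          (l (s - 5 + i - k) * totalX^[k] (lowLin F i)) := by
    refine Finset.sum_congr rfl fun i hi => Finset.sum_congr rfl fun k _ => ?_
    rw [hlow i hi, cast_ringChoose]
    push_cast
    rfl
  have split : ∀ g : ℕ → localFun,
      ∑ i ∈ Finset.range 6, g i = ∑ i ∈ Finset.range 4, g i + g 4 + g 5 := fun g => by
    rw [Finset.sum_range_succ, Finset.sum_range_succ]
  have hX := split fun i => ∑ k ∈ Finset.range 6,
    (i.choose k : ℝ) • (adjCoeff F i * totalX^[k] (l (s - 5 + i - k)))
  have hY := split fun i => ∑ k ∈ Finset.range 10,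
    ((Ring.choose (n - (s - 5 + i - k)) k : ℤ) : ℝ) •
      (l (s - 5 + i - k) * totalX^[k] (pder (.u i) F))
  rw [hA, hC, adjCoeff_four h4 h5 hF] at hX
  rw [hB, hD, h4] at hY
  unfold residual lowerResidual
  rw [hX, hY]
  simp only [iterate_totalX_zero, mul_zero, zero_mul, smul_zero, Finset.sum_const_zero]
  ring

end Residual

theorem iterate_totalX_mul {a : localFun} (ha : totalX a = 0) (k : ℕ) (f : localFun) :
    totalX^[k] (a * f) = a * totalX^[k] f := by
  induction k with
  | zero => rfl
  | succ k ih => simp [Function.iterate_succ_apply', ih, Derivation.leibniz, ha]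

theorem lowerResidual_mul {a : localFun} (ha : totalX a = 0)
    {D : Derivation ℝ localFun localFun} (hD : D a = 0) (c : ℝ) (f : ℕ → localFun) (ν : ℝ)
    (l : ℤ → localFun) (s : ℤ) :
    lowerResidual c totalX D f ν (fun q => a * l q) s = a * lowerResidual c totalX D f ν l s := by
  unfold lowerResidual
  simp only [iterate_totalX_mul ha, Derivation.leibniz, hD, smul_eq_mul, mul_zero, add_zero,
    mul_add, mul_sub, Finset.mul_sum, mul_smul_comm]
  simp only [mul_left_comm a, mul_assoc]

/-- With `l q` of weight `q` and `∂F/∂u_i` of weight `7 - 2 - i`, every summand has weight exactly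
`s`. -/
theorem leadingTerm_lowerResidual {c ν : ℝ} {F F' : localFun} (hF : LeadingTerm 7 F F')
    {f f' : ℕ → localFun} (hf : ∀ i : ℕ, LeadingTerm (5 - i) (f i) (f' i)) {l m : ℤ → localFun}
    {s : ℤ} (hl : ∀ q, q ≤ s - 2 → LeadingTerm q (l q) (m q)) :
    LeadingTerm s (lowerResidual c totalX (totalT F) f ν l s)
      (lowerResidual c totalX (evolutionary F') f' ν m s) := by
  have cast : ∀ {k k' : ℤ} {g g' : localFun}, LeadingTerm k g g' → k = k' →
      LeadingTerm k' g g' := fun h e => e ▸ h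
  unfold lowerResidual
  refine LeadingTerm.add (LeadingTerm.add (LeadingTerm.sub ?_ ?_) ?_) ?_
  · exact cast ((hl (s - 5) (by omega)).totalT hF (by norm_num)) (by ring)
  · refine LeadingTerm.sum _ fun k _ => LeadingTerm.smul ?_ _
    exact cast ((hl (s - (k + 2 : ℕ)) (by push_cast; omega)).iterate_totalX (k + 2)) (by ring)
  · refine LeadingTerm.sum _ fun i hi => LeadingTerm.sum _ fun k _ => LeadingTerm.smul ?_ _
    have hi := Finset.mem_range.mp hi
    refine cast (k := (5 - i) + (s - 5 + i)) (LeadingTerm.mul ?_ ?_) (by ring)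
    · refine LeadingTerm.sum _ fun j _ => LeadingTerm.smul ?_ _
      exact cast ((hf (i + j)).iterate_totalX j) (by push_cast; ring)
    · exact cast ((hl (s - 5 + i - k) (by omega)).iterate_totalX k) (by ring)
  · refine LeadingTerm.sum _ fun i hi => LeadingTerm.sum _ fun k _ => LeadingTerm.smul ?_ _
    have hi := Finset.mem_range.mp hi
    exact cast ((hl (s - 5 + i - k) (by omega)).mul ((hf i).iterate_totalX k)) (by ring)

/-! ### The KRRI right-hand side, its linearization and its top-weight part. -/

theorem contDiff_iteratedDeriv {h : ℝ → ℝ} (hh : ContDiff ℝ ∞ h) (j : ℕ) :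
    ContDiff ℝ ∞ (iteratedDeriv j h) := by
  induction j with
  | zero => simpa using hh
  | succ j ih =>
    rw [iteratedDeriv_succ]
    exact (contDiff_infty_iff_deriv.mp ih).2

/-- The `j`-th derivative of a smooth function of `x` as a local function. -/
def ofXDeriv {h : ℝ → ℝ} (hh : ContDiff ℝ ∞ h) (j : ℕ) : localFun :=
  ofX (iteratedDeriv j h) (contDiff_iteratedDeriv hh j)

@[simp] theorem pder_u_ofXDeriv {h : ℝ → ℝ} (hh : ContDiff ℝ ∞ h) (i j : ℕ) :
    pder (.u i) (ofXDeriv hh j) = 0 := pder_u_ofX _ _ _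

@[simp] theorem totalX_ofXDeriv {h : ℝ → ℝ} (hh : ContDiff ℝ ∞ h) (j : ℕ) :
    totalX (ofXDeriv hh j) = ofXDeriv hh (j + 1) := by
  have e : deriv (iteratedDeriv j h) = iteratedDeriv (j + 1) h := iteratedDeriv_succ.symm
  unfold ofXDeriv
  rw [totalX_ofX _ _ (e ▸ contDiff_iteratedDeriv hh (j + 1))]
  exact Subtype.ext (by funext t x u; exact congrFun e x)

/-- The right-hand side of the equation as a local function. -/
def rhsLocal (a b d : ℝ) {h : ℝ → ℝ} (hh : ContDiff ℝ ∞ h) : localFun :=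
  -jet 1 - (3 / 2 * a) • (jet 0 * jet 1) - (b / 6) • jet 3 +
    (3 / 8 * a ^ 2) • (jet 0 * jet 0 * jet 1) - (23 / 24 * a * b) • (jet 1 * jet 2) -
    (5 / 12 * a * b) • (jet 0 * jet 3) +
    (d / 2) • (ofXDeriv hh 1 * jet 0 + ofXDeriv hh 0 * jet 1) +
    (b * d / 4) • (-(ofXDeriv hh 3 * jet 0) - ofXDeriv hh 2 * jet 1 + ofXDeriv hh 1 * jet 2 +
      ofXDeriv hh 0 * jet 3) - (19 / 360 * b ^ 2) • jet 5

/-- The terms of weight seven of the right-hand side. -/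
def rhsTop (a b : ℝ) : localFun :=
  (3 / 8 * a ^ 2) • (jet 0 * jet 0 * jet 1) - (23 / 24 * a * b) • (jet 1 * jet 2) -
    (5 / 12 * a * b) • (jet 0 * jet 3) - (19 / 360 * b ^ 2) • jet 5

theorem coe_rhsLocal (a b d : ℝ) {h : ℝ → ℝ} (hh : ContDiff ℝ ∞ h) :
    (rhsLocal a b d hh : JetFun) = rhs a b d h := by
  funext t x u
  change -u 1 - (3 / 2 * a) * (u 0 * u 1) - (b / 6) * u 3 +
    (3 / 8 * a ^ 2) * (u 0 * u 0 * u 1) - (23 / 24 * a * b) * (u 1 * u 2) -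
    (5 / 12 * a * b) * (u 0 * u 3) +
    (d / 2) * (iteratedDeriv 1 h x * u 0 + iteratedDeriv 0 h x * u 1) +
    (b * d / 4) * (-(iteratedDeriv 3 h x * u 0) - iteratedDeriv 2 h x * u 1 +
      iteratedDeriv 1 h x * u 2 + iteratedDeriv 0 h x * u 3) - (19 / 360 * b ^ 2) * u 5 = _
  rw [rhs, iteratedDeriv_zero]
  ring

section Linearization

variable (a b d : ℝ) {h : ℝ → ℝ} (hh : ContDiff ℝ ∞ h)

theorem pder_rhsLocal_of_lt {j : ℕ} (hj : 5 < j) : pder (.u j) (rhsLocal a b d hh) = 0 := by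
  have h' : ∀ i, i ≤ 5 → j ≠ i := fun i hi => by omega
  simp [rhsLocal, Derivation.leibniz, h']

theorem pder_rhsLocal_five :
    pder (.u 5) (rhsLocal a b d hh) = algebraMap ℝ _ (-(b ^ 2 * (19 / 360))) := by
  simp [rhsLocal, Derivation.leibniz, Algebra.algebraMap_eq_smul_one, mul_comm]

theorem pder_rhsLocal_four : pder (.u 4) (rhsLocal a b d hh) = 0 := by
  simp [rhsLocal, Derivation.leibniz]

theorem leadingTerm_rhsLocal : LeadingTerm 7 (rhsLocal a b d hh) (rhsTop a b) := by
  have hu : ∀ (j : ℕ) {k : ℤ}, (j : ℤ) + 2 ≤ k → WeightLE k (jet j) := fun j _ hk =>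
    (WeightLE.jet j).mono hk
  have hH : ∀ j, WeightLE 0 (ofXDeriv hh j) := fun j =>
    WeightLE.of_pder_u_eq_zero fun i => pder_u_ofXDeriv hh i j
  have hHu : ∀ (i j : ℕ), j ≤ 4 → WeightLE 6 (ofXDeriv hh i * jet j) := fun i j hj =>
    ((hH i).mul (hu j le_rfl)).mono (by omega)
  have huu : ∀ (i j : ℕ) {k : ℤ}, (i : ℤ) + j + 4 ≤ k → WeightLE k (jet i * jet j) :=
    fun i j _ hk => ((hu i le_rfl).mul (hu j le_rfl)).mono (by omega)
  constructor
  · exact (((((huu 0 0 (k := 4) (by norm_num)).mul (hu 1 (k := 3) (by norm_num))).smul _).sub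
      ((huu 1 2 (by norm_num)).smul _)).sub ((huu 0 3 (by norm_num)).smul _)).sub
      ((hu 5 (by norm_num)).smul _)
  · have e : rhsLocal a b d hh - rhsTop a b =
        -jet 1 - (3 / 2 * a) • (jet 0 * jet 1) - (b / 6) • jet 3 +
        (d / 2) • (ofXDeriv hh 1 * jet 0 + ofXDeriv hh 0 * jet 1) +
        (b * d / 4) • (-(ofXDeriv hh 3 * jet 0) - ofXDeriv hh 2 * jet 1 + ofXDeriv hh 1 * jet 2 +
          ofXDeriv hh 0 * jet 3) := by
      unfold rhsLocal rhsTop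
      ring
    rw [e]
    exact ((((hu 1 (by norm_num)).neg.sub ((huu 0 1 (by norm_num)).smul _)).sub
      ((hu 3 (by norm_num)).smul _)).add
      (((hHu 1 0 (by norm_num)).add (hHu 0 1 (by norm_num))).smul _)).add
      ((((((hHu 3 0 (by norm_num)).neg).sub (hHu 2 1 (by norm_num))).add
        (hHu 1 2 (by norm_num))).add (hHu 0 3 (by norm_num))).smul _)

theorem lowLin_rhsTop (k : ℝ) (i : ℕ) :
    lowLin (rhsTop (k * b) b) i = leadingLin (b ^ 2) (fun j => k • jet j) i := by
  match i with
  | 0 =>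
    simp [lowLin, rhsTop, leadingLin, Derivation.leibniz]
    algebra
  | 1 =>
    simp [lowLin, rhsTop, leadingLin, Derivation.leibniz]
    algebra
  | 2 =>
    simp [lowLin, rhsTop, leadingLin, Derivation.leibniz]
    algebra
  | 3 =>
    simp [lowLin, rhsTop, leadingLin, Derivation.leibniz]
    algebra
  | j + 4 => simp [lowLin, leadingLin]

theorem leadingTerm_lowLin (k : ℝ) (i : ℕ) :
    LeadingTerm (5 - i) (lowLin (rhsLocal (k * b) b d hh) i)
      (leadingLin (b ^ 2) (fun j => k • jet j) i) := by
  rw [← lowLin_rhsTop]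
  have h7 := leadingTerm_rhsLocal (k * b) b d hh
  unfold lowLin
  split_ifs with hi
  · refine ⟨(h7.1.pder_u i).mono (by omega), ?_⟩
    rw [← map_sub]
    exact (h7.2.pder_u i).mono (by omega)
  · exact .zero _

theorem evolutionary_rhsTop (k : ℝ) (j : ℕ) :
    evolutionary (rhsTop (k * b) b) (k • jet j) = totalX^[j]
      ((b ^ 2 * (3 / 8)) • ((k • jet 0) * (k • jet 0) * (k • jet 1)) -
        (b ^ 2 * (23 / 24)) • ((k • jet 1) * (k • jet 2)) -
        (b ^ 2 * (5 / 12)) • ((k • jet 0) * (k • jet 3)) - (b ^ 2 * (19 / 360)) • (k • jet 5)) := by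
  have e : ∀ f, totalX^[j] (k • f) = k • totalX^[j] f := fun f => by
    induction j with
    | zero => rfl
    | succ j ih => rw [Function.iterate_succ_apply', ih, Derivation.map_smul,
        Function.iterate_succ_apply']
  rw [Derivation.map_smul, evolutionary, vertical_jet, ← e]
  congr 1
  unfold rhsTop
  algebra

end Linearization

theorem lowerResidual_eq_zero {A : Type*} [CommRing A] [Algebra ℝ A] (c : ℝ)
    (δ D : Derivation ℝ A A) (f : ℕ → A) (ν : ℝ) {l : ℤ → A} {s : ℤ}
    (hl : ∀ q, q ≤ s - 2 → l q = 0) : lowerResidual c δ D f ν l s = 0 := by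
  have hδ : ∀ k, δ^[k] 0 = 0 := fun k => by
    induction k with
    | zero => rfl
    | succ k ih => rw [Function.iterate_succ_apply', ih, map_zero]
  have h1 : ∀ i ∈ Finset.range 4, ∀ k : ℕ, l (s - 5 + i - k) = 0 := fun i hi k => by
    have := Finset.mem_range.mp hi
    exact hl _ (by omega)
  unfold lowerResidual
  rw [hl (s - 5) (by omega), map_zero, Finset.sum_eq_zero, Finset.sum_eq_zero,
    Finset.sum_eq_zero, sub_zero, add_zero, add_zero]
  · exact fun i hi => Finset.sum_eq_zero fun k _ => by rw [h1 i hi, zero_mul, smul_zero]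
  · exact fun i hi => Finset.sum_eq_zero fun k _ => by rw [h1 i hi, hδ, mul_zero, smul_zero]
  · exact fun k _ => by rw [hl _ (by push_cast; omega), hδ, smul_zero]

theorem leadingCoeff_of_neg (ν : ℝ) (v : ℕ → localFun) {q : ℤ} (hq : q < 0) :
    leadingCoeff ν v q = 0 := by
  match q, hq with
  | Int.negSucc _, _ => rfl

theorem WeightLE.of_smul {k : ℤ} {f : localFun} {r : ℝ} (hr : r ≠ 0) (h : WeightLE k (r • f)) :
    WeightLE k f := by
  have := h.smul r⁻¹
  rwa [smul_smul, inv_mul_cancel₀ hr, one_smul] at this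

/-! ### The obstruction at rank ten. -/

section Leading

variable {k b d : ℝ} {h : ℝ → ℝ} {hh : ContDiff ℝ ∞ h} {n : ℤ} {l : ℤ → localFun}

theorem residual_rhsLocal_eq_zero_iff (a : ℝ) {s : ℤ} :
    residual (rhsLocal a b d hh) n l s = 0 ↔
      lowerResidual (-(b ^ 2 * (19 / 360))) totalX (totalT (rhsLocal a b d hh))
        (lowLin (rhsLocal a b d hh)) n l s =
      (5 * -(b ^ 2 * (19 / 360))) • totalX (l (s - 1)) := by
  rw [residual_eq (pder_rhsLocal_four a b d hh) (pder_rhsLocal_five a b d hh)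
    (fun j hj => pder_rhsLocal_of_lt a b d hh hj), sub_eq_zero]

theorem leading_const (a : ℝ) (hb : b ≠ 0) (hl : ∀ q, q < 0 → l q = 0)
    (hE : residual (rhsLocal a b d hh) n l 1 = 0) :
    totalX (l 0) = 0 ∧ ∀ j, pder (.u j) (l 0) = 0 := by
  have h0 : totalX (l 0) = 0 := by
    have e := residual_rhsLocal_eq_zero_iff a |>.mp hE
    rw [lowerResidual_eq_zero _ _ _ _ _ fun q hq => hl q (by omega)] at e
    have h5 : (5 * -(b ^ 2 * (19 / 360))) ≠ 0 := by
      have := pow_ne_zero 2 hb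
      simpa using this
    have := congrArg ((5 * -(b ^ 2 * (19 / 360)))⁻¹ • ·) e
    simp only [smul_zero, smul_smul, inv_mul_cancel₀ h5, one_smul] at this
    exact this.symm
  exact ⟨h0, pder_eq_zero_of_totalX (k := 0) (by rw [h0]; exact .zero _) (by norm_num)⟩

/-- Equation `q + 1` fixes `D_x l_q` up to lower weight. Integrating loses only constants of weight
zero, which are lower-order terms as soon as `q ≥ 1`. -/
theorem leadingTerm_coeff (hb : b ≠ 0) (hl : ∀ q, q < 0 → l q = 0)
    (hE : ∀ s : ℤ, s ≤ 9 → residual (rhsLocal (k * b) b d hh) n l s = 0) (N : ℕ) (hN : N ≤ 7) :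
    ∀ q : ℤ, q ≤ N →
      LeadingTerm q (l q) (l 0 * leadingCoeff (n : ℝ) (fun j => k • jet j) q) := by
  obtain ⟨hx, hu⟩ := leading_const (k * b) hb hl (hE 1 (by norm_num))
  have h5 : (5 * -(b ^ 2 * (19 / 360))) ≠ 0 := by
    have := pow_ne_zero 2 hb
    simpa using this
  induction N with
  | zero =>
    intro q hq
    rcases (by omega : q < 0 ∨ q = 0) with hq | rfl
    · rw [hl q hq, leadingCoeff_of_neg _ _ hq, mul_zero]
      exact .zero _
    · rw [leadingCoeff, mul_one]
      exact .refl (.of_pder_u_eq_zero hu)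
  | succ N ih =>
    intro q hq
    rcases (by omega : q ≤ (N : ℤ) ∨ q = N + 1) with hq | hq
    · exact ih (by omega) q hq
    have htop : lowerResidual (-(b ^ 2 * (19 / 360))) totalX (evolutionary (rhsTop (k * b) b))
        (leadingLin (b ^ 2) fun j => k • jet j) n (leadingCoeff (n : ℝ) fun j => k • jet j)
        (q + 1) = (5 * -(b ^ 2 * (19 / 360))) •
          totalX (leadingCoeff (n : ℝ) (fun j => k • jet j) (q + 1 - 1)) :=
      lowerResidual_leadingCoeff (β := b ^ 2) (v := fun j => k • jet j) (δ := totalX)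
      (D := evolutionary (rhsTop (k * b) b)) (s := q + 1) (n : ℝ)
      (fun j => by rw [Derivation.map_smul, totalX_jet]) (fun j => evolutionary_rhsTop b k j)
      (by omega) (by omega)
    have hmul := lowerResidual_mul hx
      (show evolutionary (rhsTop (k * b) b) (l 0) = 0 from vertical_eq_zero _ _ hu)
      (-(b ^ 2 * (19 / 360))) (leadingLin (b ^ 2) fun j => k • jet j) n
      (leadingCoeff (n : ℝ) fun j => k • jet j) (q + 1)
    rw [htop] at hmul
    have hlead := leadingTerm_lowerResidual (c := -(b ^ 2 * (19 / 360))) (ν := n) (s := q + 1)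
      (leadingTerm_rhsLocal (k * b) b d hh) (leadingTerm_lowLin b d hh k)
      (fun q' hq' => ih (by omega) q' (by omega))
    rw [hmul, (residual_rhsLocal_eq_zero_iff _).mp (hE (q + 1) (by omega)),
      add_sub_cancel_right, mul_smul_comm] at hlead
    have hcomm : l 0 * totalX (leadingCoeff (n : ℝ) (fun j => k • jet j) q) =
        totalX (l 0 * leadingCoeff (n : ℝ) (fun j => k • jet j) q) := by
      simp [Derivation.leibniz, hx]
    rw [hcomm] at hlead
    refine ⟨(hlead.1.of_smul h5).of_totalX.mono (by omega), ?_⟩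
    have h2 := hlead.2
    rw [← smul_sub, ← map_sub] at h2
    exact (h2.of_smul h5).of_totalX.mono (by omega)

theorem leading_eq_zero_of_rank_ten (hk : k ≠ 0) (hb : b ≠ 0) (hl : ∀ q, q < 0 → l q = 0)
    (hE : ∀ s : ℤ, s ≤ 9 → residual (rhsLocal (k * b) b d hh) n l s = 0) : l 0 = 0 := by
  obtain ⟨hx, hu⟩ := leading_const (k * b) hb hl (hE 1 (by norm_num))
  have h5 : (5 * -(b ^ 2 * (19 / 360))) ≠ 0 := by
    have := pow_ne_zero 2 hb
    simpa using this
  have htop : lowerResidual (-(b ^ 2 * (19 / 360))) totalX (evolutionary (rhsTop (k * b) b))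
      (leadingLin (b ^ 2) fun j => k • jet j) n (leadingCoeff (n : ℝ) fun j => k • jet j) 9 =
      (5 * -(b ^ 2 * (19 / 360))) • (totalX (leadingCoeff (n : ℝ) (fun j => k • jet j) 8) +
        ((12717 * (n : ℝ) + 67797) / 6859) • (k • jet 1 * k • jet 1 * k • jet 1)) :=
    lowerResidual_leadingCoeff_nine (β := b ^ 2) (v := fun j => k • jet j)
    (δ := totalX) (D := evolutionary (rhsTop (k * b) b)) (n : ℝ)
    (fun j => by rw [Derivation.map_smul, totalX_jet]) (fun j => evolutionary_rhsTop b k j)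
  have hmul := lowerResidual_mul hx
    (show evolutionary (rhsTop (k * b) b) (l 0) = 0 from vertical_eq_zero _ _ hu)
    (-(b ^ 2 * (19 / 360))) (leadingLin (b ^ 2) fun j => k • jet j) n
    (leadingCoeff (n : ℝ) fun j => k • jet j) 9
  rw [htop] at hmul
  have hlead := leadingTerm_lowerResidual (c := -(b ^ 2 * (19 / 360))) (ν := n) (s := 9)
    (leadingTerm_rhsLocal (k * b) b d hh) (leadingTerm_lowLin b d hh k)
    (fun q' hq' => leadingTerm_coeff hb hl hE 7 le_rfl q' (by omega))
  rw [hmul, (residual_rhsLocal_eq_zero_iff _).mp (hE 9 (by norm_num)), mul_smul_comm] at hlead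
  have h2 := hlead.2
  rw [← smul_sub] at h2
  set κ : ℝ := (12717 * (n : ℝ) + 67797) / 6859 * k ^ 3 with hκ
  have hκ0 : κ ≠ 0 := by
    have h0 : (12717 * (n : ℝ) + 67797) ≠ 0 := by
      -- The only root is `-837/157`, not an integer.
      have : (12717 * n + 67797 : ℤ) ≠ 0 := by omega
      exact_mod_cast this
    rw [hκ]
    positivity
  set g := l 8 - l 0 * leadingCoeff (n : ℝ) (fun j => k • jet j) 8 with hg
  have e : totalX g = (κ • l 0) * jet 1 ^ 3 + (totalX (l (9 - 1)) -
      l 0 * (totalX (leadingCoeff (n : ℝ) (fun j => k • jet j) 8) +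
        ((12717 * (n : ℝ) + 67797) / 6859) • (k • jet 1 * k • jet 1 * k • jet 1))) := by
    rw [hg, hκ, map_sub, Derivation.leibniz, hx, smul_zero, add_zero, smul_eq_mul]
    norm_num
    algebra
  have := eq_zero_of_totalX_eq_cube (c := κ • l 0)
    (fun j => by rw [Derivation.map_smul, hu, smul_zero]) (h2.of_smul h5) e
  have h' := congrArg (κ⁻¹ • ·) this
  simpa [smul_smul, hκ0] using h'

end Leading

/-! ### The obstruction at rank six for nonconstant `h`. -/

section Nonconstant

variable {a b d : ℝ} {h : ℝ → ℝ} {hh : ContDiff ℝ ∞ h} {n : ℤ} {l : ℤ → localFun}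

theorem exists_lowLin_eq (a b d : ℝ) (hh : ContDiff ℝ ∞ h) {β : ℝ} (hβ : β ≠ 0) :
    ∃ r w : ℕ → localFun, (∀ j, totalX (r j) = r (j + 1)) ∧ (∀ j, totalX (w j) = w (j + 1)) ∧
      lowLin (rhsLocal a b d hh) = exactLin β
        (fun j => totalX^[j] (β⁻¹ • ((b * d / 4) • ofXDeriv hh 0 - algebraMap ℝ _ (b / 6) -
          (5 / 12 * a * b) • jet 0)))
        (fun j => totalX^[j] (β⁻¹ • ((b * d / 4) • ofXDeriv hh 0 - (23 / 24 * a * b) • jet 0)))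
        r w := by
  have it : ∀ (f : localFun) (j : ℕ), totalX (totalX^[j] f) = totalX^[j + 1] f := fun f j =>
    (Function.iterate_succ_apply' _ _ _).symm
  refine ⟨fun j => totalX^[j] (β⁻¹ • pder (.u 1) (rhsLocal a b d hh)),
    fun j => totalX^[j] (β⁻¹ • (-(3 / 2 * a) • jet 0 + (3 / 8 * a ^ 2) • (jet 0 * jet 0) -
      (5 / 12 * a * b) • jet 2 + (d / 2) • ofXDeriv hh 0 - (b * d / 4) • ofXDeriv hh 2)),
    it _, it _, ?_⟩
  funext i
  match i with
  | 0 =>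
    simp [lowLin, exactLin, smul_smul, hβ, rhsLocal, Derivation.leibniz]
    algebra
  | 1 => simp [lowLin, exactLin, smul_smul, hβ]
  | 2 =>
    simp [lowLin, exactLin, smul_smul, hβ, rhsLocal, Derivation.leibniz]
    algebra
  | 3 =>
    simp [lowLin, exactLin, smul_smul, hβ, rhsLocal, Derivation.leibniz]
    algebra
  | j + 4 => simp [lowLin, exactLin]

set_option maxHeartbeats 4000000 in
theorem exists_potential_rhsLocal (hb : b ≠ 0) (hl : ∀ q, q < 0 → l q = 0)
    (hE : ∀ s : ℤ, s ≤ 5 → residual (rhsLocal a b d hh) n l s = 0) :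
    ∃ g, totalX g = totalT (rhsLocal a b d hh) (l 0) +
      (144 / (19 * b ^ 2)) • (l 0 *
        (((b * d / 4) • ofXDeriv hh 0 - algebraMap ℝ _ (b / 6) - (5 / 12 * a * b) • jet 0) *
          ((b * d / 4) • ofXDeriv hh 1 - (23 / 24 * a * b) • jet 1))) := by
  obtain ⟨β, hβ⟩ : ∃ β : ℝ, β = 5 * -(b ^ 2 * (19 / 360)) := ⟨_, rfl⟩
  have hβ0 : β ≠ 0 := by
    have := pow_ne_zero 2 hb
    simpa [hβ] using this
  obtain ⟨r, w, hr, hw, e⟩ := exists_lowLin_eq a b d hh hβ0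
  obtain ⟨p, hp⟩ : ∃ p : localFun, p = (b * d / 4) • ofXDeriv hh 0 - algebraMap ℝ _ (b / 6) -
    (5 / 12 * a * b) • jet 0 := ⟨_, rfl⟩
  obtain ⟨q, hq⟩ : ∃ q : localFun, q = (b * d / 4) • ofXDeriv hh 0 - (23 / 24 * a * b) • jet 0 :=
    ⟨_, rfl⟩
  have hqx : totalX q = (b * d / 4) • ofXDeriv hh 1 - (23 / 24 * a * b) • jet 1 := by
    rw [hq]
    simp
  rw [← hp, ← hq] at e
  rw [← hp, ← hqx]
  have hE' : ∀ s : ℤ, 1 ≤ s → s ≤ 5 → lowerResidual (β / 5) totalX (totalT (rhsLocal a b d hh))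
      (exactLin β (fun j => totalX^[j] (β⁻¹ • p)) (fun j => totalX^[j] (β⁻¹ • q)) r w) n l s =
      β • totalX (l (s - 1)) := fun s _ hs => by
    have h5 : β / 5 = -(b ^ 2 * (19 / 360)) := by
      rw [hβ]
      ring
    rw [← e, h5, hβ]
    exact (residual_rhsLocal_eq_zero_iff a).mp (hE s hs)
  obtain ⟨g, hg⟩ : ∃ g, totalX g = totalT (rhsLocal a b d hh) (l 0) -
      (2 * β) • (l 0 * ((β⁻¹ • p) * totalX (β⁻¹ • q))) :=
    exists_potential (p := fun j => totalX^[j] (β⁻¹ • p)) (q := fun j => totalX^[j] (β⁻¹ • q)) hβ0 (fun j => (Function.iterate_succ_apply' _ _ _).symm)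
      (fun j => (Function.iterate_succ_apply' _ _ _).symm) hr hw hl hE'
  refine ⟨g, ?_⟩
  have hββ : (2 * β) * (β⁻¹ * β⁻¹) = -(144 / (19 * b ^ 2)) := by
    rw [hβ]
    field_simp
    norm_num
  rw [hg, Derivation.map_smul, smul_mul_smul_comm, mul_smul_comm, smul_smul, hββ, neg_smul,
    sub_neg_eq_add]

/-- After removal of exact terms, `D_x G` is a `u`-free function plus a nonzero multiple of `l_0 h'
u_0`. Its weight is at most 2, so `G` has no jet variables; then `∂/∂u_0` of `D_x G` vanishes and
yields the claim. -/
theorem leading_mul_deriv_eq_zero (ha : a ≠ 0) (hb : b ≠ 0) (hd : d ≠ 0)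
    (hl : ∀ q, q < 0 → l q = 0)
    (hE : ∀ s : ℤ, s ≤ 5 → residual (rhsLocal a b d hh) n l s = 0) :
    l 0 * ofXDeriv hh 1 = 0 := by
  obtain ⟨hx, hu⟩ := leading_const a hb hl (hE 1 (by norm_num))
  obtain ⟨g, hg⟩ := exists_potential_rhsLocal hb hl hE
  obtain ⟨κ, hκ⟩ : ∃ κ : ℝ, κ = 144 / (19 * b ^ 2) := ⟨_, rfl⟩
  obtain ⟨P, hP⟩ : ∃ P : localFun, P = (b * d / 4) • ofXDeriv hh 0 - algebraMap ℝ _ (b / 6) :=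
    ⟨_, rfl⟩
  have hPx : totalX P = (b * d / 4) • ofXDeriv hh 1 := by
    rw [hP]
    simp
  rw [← hκ, ← hP] at hg
  have hT : ∀ j, pder (.u j) (totalT (rhsLocal a b d hh) (l 0)) = 0 := fun j => by
    rw [totalT, Derivation.add_apply, evolutionary, vertical_eq_zero _ _ hu, add_zero, pder_comm,
      hu, map_zero]
  -- The exact part of `(P - 5/12 a b u_0) D_x (P - 23/24 a b u_0)` is split off: `115/576` is half
  -- of `5/12 * 23/24`, and the remaining `13/96` is `(23/24 - 5/12) / 4`.
  obtain ⟨G, hG⟩ : ∃ G, G = g - κ • (l 0 * ((1 / 2 : ℝ) • (P * P) -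
    (23 / 24 * a * b) • (P * jet 0) + (115 / 576 * a ^ 2 * b ^ 2) • (jet 0 * jet 0))) := ⟨_, rfl⟩
  have hGx : totalX G = totalT (rhsLocal a b d hh) (l 0) +
      (κ * (13 / 96 * a * b ^ 2 * d)) • (l 0 * ofXDeriv hh 1 * jet 0) := by
    rw [hG, map_sub, hg]
    simp only [Derivation.map_smul, Derivation.leibniz, map_add, map_sub, hx, hPx, smul_eq_mul,
      totalX_jet, mul_zero, add_zero]
    algebra
  have hw2 : WeightLE 2 (totalX G) := by
    rw [hGx]
    refine ((WeightLE.of_pder_u_eq_zero hT).mono (by norm_num)).add (WeightLE.smul ?_ _)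
    exact ((WeightLE.of_pder_u_eq_zero (f := l 0 * ofXDeriv hh 1) fun j => by
      simp [Derivation.leibniz, hu]).mul (WeightLE.jet 0)).mono (by norm_num)
  have h0 := pder_totalX_zero G
  rw [pder_eq_zero_of_totalX hw2 le_rfl, map_zero, hGx, map_add, hT, zero_add,
    Derivation.map_smul] at h0
  have h1 : pder (.u 0) (l 0 * ofXDeriv hh 1 * jet 0) = l 0 * ofXDeriv hh 1 := by
    simp [Derivation.leibniz, hu]
  rw [h1] at h0
  have hμ : κ * (13 / 96 * a * b ^ 2 * d) ≠ 0 := by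
    rw [hκ]
    positivity
  have := congrArg ((κ * (13 / 96 * a * b ^ 2 * d))⁻¹ • ·) h0
  simpa only [smul_zero, smul_smul, inv_mul_cancel₀ hμ, one_smul] using this

theorem apply_eq_of_totalX_eq_zero {f : localFun} (hx : totalX f = 0)
    (hu : ∀ j, pder (.u j) f = 0) (t x y : ℝ) (u : ℕ → ℝ) :
    (f : JetFun) t x u = (f : JetFun) t y u := by
  rw [totalX, Derivation.add_apply, vertical_eq_zero _ _ hu, add_zero] at hx
  obtain ⟨m, g, hg, e⟩ := f.2
  refine is_const_of_deriv_eq_zero (f := fun s => (f : JetFun) t s u) ?_ (fun s => ?_) x y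
  · simp only [e]
    exact (hg.comp (f := fun s : ℝ => (t, s, fun i : Fin m => u i)) (by fun_prop)).differentiable
      (by simp)
  · exact congrFun (congrFun (congrFun (congrArg Subtype.val hx) t) s) u

end Nonconstant

end KRRI

end

theorem theorem3 (a b d : ℝ) (ha : a ≠ 0) (hb : b ≠ 0) (hd : d ≠ 0)
    (h : ℝ → ℝ) (hh : ContDiff ℝ ∞ h) :
    (∀ k : ℤ, 10 ≤ k →
      ¬ ∃ L : KRRI.Series, KRRI.IsFormalSymplecticOperator (KRRI.rhs a b d h) L k) ∧
    ((¬ ∃ c : ℝ, ∀ x : ℝ, h x = c) → ∀ k : ℤ, 6 ≤ k →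
      ¬ ∃ L : KRRI.Series, KRRI.IsFormalSymplecticOperator (KRRI.rhs a b d h) L k) := by
  constructor
  · rintro r hr ⟨L, hL⟩
    -- The rescaling `v = k u` makes the top-weight equation independent of the parameters up to the
    -- factor `b^2`.
    obtain ⟨k, rfl⟩ : ∃ k, a = k * b := ⟨a / b, by field_simp⟩
    rw [← KRRI.coe_rhsLocal (k * b) b d hh] at hL
    obtain ⟨n, l, h0, hl, hE⟩ := hL.exists_residual_eq_zero fun j hj =>
      KRRI.pder_rhsLocal_of_lt (k * b) b d hh hj
    exact h0 (KRRI.leading_eq_zero_of_rank_ten (left_ne_zero_of_mul ha) hb hl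
      fun s hs => hE s hs (by omega))
  · rintro hc r hr ⟨L, hL⟩
    rw [← KRRI.coe_rhsLocal a b d hh] at hL
    obtain ⟨n, l, h0, hl, hE⟩ := hL.exists_residual_eq_zero fun j hj =>
      KRRI.pder_rhsLocal_of_lt a b d hh hj
    obtain ⟨hx, hu⟩ := KRRI.leading_const a hb hl (hE 1 (by norm_num) (by omega))
    have hz := KRRI.leading_mul_deriv_eq_zero ha hb hd hl fun s hs => hE s (by omega) (by omega)
    have hy : ∃ y, deriv h y ≠ 0 := by
      by_contra! hall
      exact hc ⟨h 0, fun x =>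
        is_const_of_deriv_eq_zero (hh.differentiable (by simp)) hall x 0⟩
    obtain ⟨y, hy⟩ := hy
    refine h0 (Subtype.ext ?_)
    funext t x u
    -- As `l 0` does not depend on `x`, its vanishing may be tested at a single point where `h' ≠
    -- 0`.
    rw [KRRI.apply_eq_of_totalX_eq_zero hx hu t x y u]
    have e := congrFun (congrFun (congrFun (congrArg Subtype.val hz) t) y) u
    have e' : (l 0 : KRRI.JetFun) t y u * iteratedDeriv 1 h y = 0 := e
    rw [iteratedDeriv_one] at e'
    exact (mul_eq_zero.mp e').resolve_right hy
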